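/- Let $H^1_0$ be the Hilbert space of absolutely continuous $g:[0,\infty)\to\mathbb R$ with $g(0)=0$ and $\|g\|_{H^1_0}^2=\int_0^\infty \dot g(t)^2\,dt<\infty$, and let $H^U$ be the Hilbert space of absolutely continuous $h:\mathbb R\to\mathbb R$ with $\|h\|_{H^U}^2=\int_{\mathbb R}\bigl(\tfrac14h(t)^2+\dot h(t)^2\bigr)dt<\infty$. Let $\mathcal U$ be the Banach space of continuous $\omega:\mathbb R\to\mathbb R$ with $|\omega(t)|/\log|t|\to0$ as $|t|\to\infty$, with norm $\sup_t|\omega(t)|/\log(e+|t|)$; then $H^U\subset\mathcal U$. Write $\hat h(\lambda)=\int e^{-i\lambda x}h(x)\,dx$ (in the $L^2$ sense). (1) For every $u\in\mathbb R$ there is exactly one map $\mathcal S^u:H^U\to H^U$ with $\widehat{\mathcal S^uh}(\lambda)=e^{-2iu\arctan(2\lambda)}\,\hat h(\lambda)$ for all $h\in H^U$ and almost every $\lambda$. Each $\mathcal S^u$ is an orthogonal transformation of $H^U$, $\mathcal S^0=\mathrm{id}$, $\mathcal S^{u+v}=\mathcal S^u\circ\mathcal S^v$ for all $u,v\in\mathbb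 R$, and $u\mapsto\mathcal S^uh$ is continuous for each $h\in H^U$. (2) The formula $[F(g)](t)=e^{-t/2}g(e^t)$ defines an isometric isomorphism $F$ of $H^1_0$ onto $H^U$, the formula $[\mathcal Og](t)=g(t)-\int_0^t\frac{g(s)}s\,ds$ defines an orthogonal transformation $\mathcal O$ of $H^1_0$, and $\mathcal S^1=-F\circ\mathcal O\circ F^{-1}$. (3) For all $g,h\in H^U$, $(g,\mathcal S^uh)_{H^U}\to0$ as $|u|\to\infty$. (4) Let $\mathcal W=\mathcal W_{H^U}$ be the Borel probability measure on $\mathcal U$ that makes $(H^U,\mathcal U,\mathcal W)$ an abstract Wiener space, i.e. for each $x^*\in\mathcal U^*$ the variable $\langle\cdot,x^*\rangle$ is centered Gaussian under $\mathcal W$ with variance $\|h_{x^*}\|_{H^U}^2$, where $h_{x^*}\in H^U$ is given by $(h,h_{x^*})_{H^U}=\langle h,x^*\rangle$ for all $h\in H^U$. Then $\mathcal W$ is the law of the standard stationary Ornstein–Uhlenbeck process: under $\mathcal W$, $(\omega(t))_{t\in\mathbb R}$ is a centered Gaussian process with covariance $e^{-|t-s|/2}$. There is a unique linear isometry $\mathcal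 I:H^U\to L^2(\mathcal W)$ with $\mathcal I(h_{x^*})=\langle\cdot,x^*\rangle$ for all $x^*\in\mathcal U^*$ (the Paley–Wiener map). For each $u$ there is a $\mathcal W$-almost surely unique Borel map $S^u:\mathcal U\to\mathcal U$ with $\mathcal I(h)\circ S^u=\mathcal I\bigl((\mathcal S^u)^\top h\bigr)$ $\mathcal W$-almost surely for every $h\in H^U$ and every representative of $\mathcal I(h)$. The maps $S^u$ form a flow, i.e. $S^0=\mathrm{id}$ and, for all $u,v\in\mathbb R$, $S^{u+v}=S^u\circ S^v$, $\mathcal W$-almost surely; each $S^u$ preserves $\mathcal W$; and $S^u$ is ergodic for $\mathcal W$ for every $u\neq0$. -/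

import Mathlib

open MeasureTheory ProbabilityTheory Filter Topology
open scoped RealInnerProductSpace FourierTransform ZeroAtInfty ENNReal

noncomputable section

namespace OUFlow

/-! ### Functions on the line with square-integrable derivative -/

/-- `h : ℝ → ℝ` is absolutely continuous (on every compact interval) and its almost everywhere
defined derivative is square integrable. -/
def ACL2 (h : ℝ → ℝ) : Prop :=
  (∀ a b : ℝ, AbsolutelyContinuousOnInterval h a b) ∧ MemLp (deriv h) 2 volume

namespace ACL2

variable {f g : ℝ → ℝ}

lemma ae_differentiableAt (hf : ACL2 f) : ∀ᵐ x, DifferentiableAt ℝ f x := by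
  have h : ∀ n : ℕ, ∀ᵐ x, x ∈ Set.uIcc (-(n : ℝ)) n → DifferentiableAt ℝ f x :=
    fun n => (hf.1 _ _).ae_differentiableAt
  filter_upwards [ae_all_iff.2 h] with x hx
  obtain ⟨n, hn⟩ := exists_nat_ge |x|
  refine hx n ?_
  rw [Set.uIcc_of_le (by linarith [abs_nonneg x])]
  exact ⟨by linarith [neg_abs_le x], by linarith [le_abs_self x]⟩

lemma deriv_add_ae (hf : ACL2 f) (hg : ACL2 g) : deriv (f + g) =ᵐ[volume] deriv f + deriv g := by
  filter_upwards [hf.ae_differentiableAt, hg.ae_differentiableAt] with x h1 h2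
  exact deriv_add h1 h2

lemma deriv_smul_eq (c : ℝ) : deriv (c • f) = c • deriv f := by
  funext x
  exact deriv_const_smul_field c f

lemma add (hf : ACL2 f) (hg : ACL2 g) : ACL2 (f + g) :=
  ⟨fun a b => (hf.1 a b).add (hg.1 a b),
    (memLp_congr_ae (deriv_add_ae hf hg)).2 (hf.2.add hg.2)⟩

lemma smul (c : ℝ) (hf : ACL2 f) : ACL2 (c • f) :=
  ⟨fun a b => (hf.1 a b).const_smul c, by rw [deriv_smul_eq]; exact hf.2.const_smul c⟩

lemma zero : ACL2 (0 : ℝ → ℝ) := by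
  refine ⟨fun a b => ?_, ?_⟩
  · exact (LipschitzWith.const (0 : ℝ)).lipschitzOnWith.absolutelyContinuousOnInterval
  · have : deriv (0 : ℝ → ℝ) = 0 := by funext x; exact deriv_const x 0
    rw [this]; exact MemLp.zero

lemma continuous (hf : ACL2 f) : Continuous f := by
  rw [continuous_iff_continuousAt]
  intro x
  refine (hf.1 (x - 1) (x + 1)).continuousOn.continuousAt ?_
  rw [Set.uIcc_of_le (by linarith)]
  exact Icc_mem_nhds (by linarith) (by linarith)

lemma integrable_deriv_mul (hf : ACL2 f) (hg : ACL2 g) :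
    Integrable (fun t => deriv f t * deriv g t) := hf.2.integrable_mul hg.2

end ACL2

/-! ### The Cameron–Martin space of Brownian motion -/

/-- Underlying vector space of `H10`: functions on `[0, ∞)` vanishing at `0`, absolutely continuous,
with square-integrable derivative. A function on `[0, ∞)` vanishing at `0` is identified with its
extension by `0` to the whole line. -/
def H10Submodule : Submodule ℝ (ℝ → ℝ) where
  carrier := {g | (∀ t ≤ 0, g t = 0) ∧ ACL2 g}
  add_mem' hf hg := ⟨fun t ht => by simp [hf.1 t ht, hg.1 t ht], hf.2.add hg.2⟩
  zero_mem' := ⟨fun _ _ => rfl, ACL2.zero⟩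
  smul_mem' c _ hf := ⟨fun t ht => by simp [hf.1 t ht], hf.2.smul c⟩

/-- The Cameron–Martin space `H¹₀` of Brownian motion, with `‖g‖² = ∫₀^∞ ġ(t)² dt`. -/
def H10 : Type := H10Submodule

namespace H10

instance : AddCommGroup H10 := inferInstanceAs (AddCommGroup H10Submodule)
instance : Module ℝ H10 := inferInstanceAs (Module ℝ H10Submodule)

instance : FunLike H10 ℝ ℝ where
  coe g := g.1
  coe_injective _ _ h := Subtype.ext h

lemma coe_add (f g : H10) : ⇑(f + g) = ⇑f + ⇑g := rfl
lemma coe_smul (c : ℝ) (f : H10) : ⇑(c • f) = c • ⇑f := rfl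
lemma coe_zero : ⇑(0 : H10) = 0 := rfl
lemma acl2 (g : H10) : ACL2 g := g.2.2
lemma eq_zero_of_nonpos (g : H10) {t : ℝ} (ht : t ≤ 0) : g t = 0 := g.2.1 t ht

instance innerCore : InnerProductSpace.Core ℝ H10 where
  inner f g := ∫ t in Set.Ioi (0 : ℝ), deriv f t * deriv g t
  conj_inner_symm f g := by simp [mul_comm]
  re_inner_nonneg f := by
    simp only [RCLike.re_to_real]
    exact integral_nonneg fun t => mul_self_nonneg _
  add_left f g h := by
    rw [← integral_add (f.acl2.integrable_deriv_mul h.acl2).integrableOn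
      (g.acl2.integrable_deriv_mul h.acl2).integrableOn]
    refine integral_congr_ae (ae_restrict_of_ae ?_)
    filter_upwards [ACL2.deriv_add_ae f.acl2 g.acl2] with t ht
    rw [coe_add, ht, Pi.add_apply, add_mul]
  smul_left f g c := by
    rw [coe_smul, ACL2.deriv_smul_eq, ← integral_const_mul]
    simp [mul_assoc]
  definite f hf := by
    have h0 : ∀ᵐ t, t ∈ Set.Ioi (0 : ℝ) → deriv f t = 0 := by
      have := (integral_eq_zero_iff_of_nonneg (fun t => mul_self_nonneg (deriv f t))
        (f.acl2.integrable_deriv_mul f.acl2).integrableOn).1 hf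
      have := (ae_restrict_iff' measurableSet_Ioi).1 this
      filter_upwards [this] with t ht h
      simpa using ht h
    refine DFunLike.ext _ _ fun t => ?_
    rcases le_or_gt t 0 with ht | ht
    · exact f.eq_zero_of_nonpos ht
    · have h1 := (f.acl2.1 0 t).integral_deriv_eq_sub
      rw [f.eq_zero_of_nonpos le_rfl, sub_zero] at h1
      rw [← h1, coe_zero, Pi.zero_apply]
      refine intervalIntegral.integral_zero_ae ?_
      filter_upwards [h0] with s hs hst
      rw [Set.uIoc_of_le ht.le] at hst
      exact hs hst.1

instance : NormedAddCommGroup H10 := innerCore.toNormedAddCommGroup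
instance : InnerProductSpace ℝ H10 := InnerProductSpace.ofCore innerCore.toCore

lemma inner_def (f g : H10) : ⟪f, g⟫ = ∫ t in Set.Ioi (0 : ℝ), deriv f t * deriv g t := rfl

end H10

/-! ### The Cameron–Martin space of the Ornstein–Uhlenbeck process -/

/-- Underlying vector space of `HU`: absolutely continuous `h : ℝ → ℝ` with
`∫ (h² / 4 + ḣ²) < ∞`. -/
def HUSubmodule : Submodule ℝ (ℝ → ℝ) where
  carrier := {h | MemLp h 2 volume ∧ ACL2 h}
  add_mem' hf hg := ⟨hf.1.add hg.1, hf.2.add hg.2⟩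
  zero_mem' := ⟨MemLp.zero, ACL2.zero⟩
  smul_mem' c _ hf := ⟨hf.1.const_smul c, hf.2.smul c⟩

/-- The Cameron–Martin space `H^U` of the Ornstein–Uhlenbeck process, with
`‖h‖² = ∫ (h(t)² / 4 + ḣ(t)²) dt`. -/
def HU : Type := HUSubmodule

namespace HU

instance : AddCommGroup HU := inferInstanceAs (AddCommGroup HUSubmodule)
instance : Module ℝ HU := inferInstanceAs (Module ℝ HUSubmodule)

instance : FunLike HU ℝ ℝ where
  coe g := g.1
  coe_injective _ _ h := Subtype.ext h

lemma coe_add (f g : HU) : ⇑(f + g) = ⇑f + ⇑g := rfl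
lemma coe_smul (c : ℝ) (f : HU) : ⇑(c • f) = c • ⇑f := rfl
lemma coe_zero : ⇑(0 : HU) = 0 := rfl
lemma acl2 (g : HU) : ACL2 g := g.2.2
lemma memLp (g : HU) : MemLp g 2 volume := g.2.1

lemma integrable_inner (f g : HU) :
    Integrable (fun t => 1 / 4 * (f t * g t) + deriv f t * deriv g t) :=
  ((f.memLp.integrable_mul g.memLp).const_mul (1 / 4)).add (f.acl2.integrable_deriv_mul g.acl2)

instance innerCore : InnerProductSpace.Core ℝ HU where
  inner f g := ∫ t, (1 / 4 * (f t * g t) + deriv f t * deriv g t)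
  conj_inner_symm f g := by simp [mul_comm]
  re_inner_nonneg f := by
    simp only [RCLike.re_to_real]
    exact integral_nonneg fun t =>
      add_nonneg (mul_nonneg (by norm_num) (mul_self_nonneg _)) (mul_self_nonneg _)
  add_left f g h := by
    rw [← integral_add (integrable_inner f h) (integrable_inner g h)]
    refine integral_congr_ae ?_
    filter_upwards [ACL2.deriv_add_ae f.acl2 g.acl2] with t ht
    rw [coe_add, ht, Pi.add_apply, Pi.add_apply]
    ring
  smul_left f g c := by
    rw [coe_smul, ACL2.deriv_smul_eq, ← integral_const_mul]
    refine integral_congr_ae (.of_forall fun t => ?_)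
    simp only [Pi.smul_apply, smul_eq_mul, conj_trivial]
    ring
  definite f hf := by
    have h0 := (integral_eq_zero_iff_of_nonneg (fun t => add_nonneg (mul_nonneg (by norm_num)
      (mul_self_nonneg (f t))) (mul_self_nonneg (deriv f t))) (integrable_inner f f)).1 hf
    have h1 : ⇑f =ᵐ[volume] (0 : ℝ → ℝ) := by
      filter_upwards [h0] with t ht
      simp only [Pi.zero_apply] at ht ⊢
      nlinarith [mul_self_nonneg (f t), mul_self_nonneg (deriv f t)]
    exact DFunLike.coe_injective (Continuous.ae_eq_iff_eq volume f.acl2.continuous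
      continuous_zero |>.1 h1)

instance : NormedAddCommGroup HU := innerCore.toNormedAddCommGroup
instance : InnerProductSpace ℝ HU := InnerProductSpace.ofCore innerCore.toCore

lemma inner_def (f g : HU) :
    ⟪f, g⟫ = ∫ t, (1 / 4 * (f t * g t) + deriv f t * deriv g t) := rfl

lemma memLp_ofReal (h : HU) : MemLp (fun t => (h t : ℂ)) 2 volume := h.memLp.ofReal

/-- The `L²` Fourier transform of `h`, with Mathlib's normalization `∫ e^{-2πi ξ x} h(x) dx`. -/
def fourier (h : HU) : Lp ℂ 2 (volume : Measure ℝ) := 𝓕 (h.memLp_ofReal.toLp _)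

/-- Elements of `H^U` are bounded. -/
lemma abs_le (h : HU) (t : ℝ) :
    |h t| ≤ ∫ s, (h s ^ 2 + deriv h s ^ 2 + (Set.Icc t (t + 1)).indicator 1 s) := by
  have hc : Continuous h := h.acl2.continuous
  have hi1 : Integrable (fun s => h s ^ 2) := h.memLp.integrable_sq
  have hi2 : Integrable (fun s => deriv h s ^ 2) := h.acl2.2.integrable_sq
  have hi3 : Integrable ((Set.Icc t (t + 1)).indicator (1 : ℝ → ℝ)) :=
    (integrable_indicator_iff measurableSet_Icc).2
      (integrableOn_const (C := (1 : ℝ)) (by simp) (by simp))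
  have hd : IntegrableOn (fun r => |deriv h r|) (Set.Icc t (t + 1)) := by
    have := (h.acl2.1 t (t + 1)).intervalIntegrable_deriv
    rw [intervalIntegrable_iff_integrableOn_Icc_of_le (by linarith)] at this
    exact this.abs
  have key : ∀ s ∈ Set.Icc t (t + 1),
      |h t| ≤ |h s| + ∫ r in Set.Icc t (t + 1), |deriv h r| := by
    intro s hs
    have h1 := (h.acl2.1 t s).integral_deriv_eq_sub
    have h2 : |∫ r in t..s, deriv h r| ≤ ∫ r in Set.Icc t (t + 1), |deriv h r| := by
      rw [intervalIntegral.integral_of_le hs.1]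
      refine (abs_integral_le_integral_abs).trans ?_
      exact setIntegral_mono_set hd (.of_forall fun _ => abs_nonneg _)
        (LE.le.eventuallyLE fun r hr => ⟨hr.1.le, hr.2.trans hs.2⟩)
    have h3 : h t = h s - ∫ r in t..s, deriv h r := by rw [h1]; ring
    calc |h t| = |h s - ∫ r in t..s, deriv h r| := by rw [← h3]
      _ ≤ |h s| + |∫ r in t..s, deriv h r| := abs_sub _ _
      _ ≤ _ := by linarith
  have hvol : volume.real (Set.Icc t (t + 1)) = 1 := by simp [Measure.real]
  have hia : IntegrableOn (fun s => |h s|) (Set.Icc t (t + 1)) :=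
    hc.abs.continuousOn.integrableOn_Icc
  have step1 : |h t| ≤ (∫ s in Set.Icc t (t + 1), |h s|) +
      ∫ r in Set.Icc t (t + 1), |deriv h r| := by
    have hm := setIntegral_mono_on (f := fun _ => |h t|)
      (g := fun s => |h s| + ∫ r in Set.Icc t (t + 1), |deriv h r|)
      (integrableOn_const (by simp) (by simp)) (hia.add (integrableOn_const (by simp) (by simp)))
      measurableSet_Icc key
    rw [integral_add hia (integrableOn_const (by simp) (by simp))] at hm
    simpa [hvol] using hm
  refine step1.trans ?_
  rw [← integral_add hia hd, ← integral_indicator measurableSet_Icc]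
  refine integral_mono ((integrable_indicator_iff measurableSet_Icc).2 (hia.add hd))
    ((hi1.add hi2).add hi3) fun s => ?_
  by_cases hs : s ∈ Set.Icc t (t + 1)
  · simp only [Set.indicator_of_mem hs, Pi.one_apply]
    nlinarith [sq_nonneg (|h s| - 1 / 2), sq_nonneg (|deriv h s| - 1 / 2), sq_abs (h s),
      sq_abs (deriv h s)]
  · simp only [Set.indicator_of_notMem hs]
    positivity

lemma exists_bound (h : HU) : ∃ C, ∀ t, |h t| ≤ C := by
  refine ⟨(∫ s, (h s ^ 2 + deriv h s ^ 2)) + 1, fun t => (h.abs_le t).trans (le_of_eq ?_)⟩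
  have hi : Integrable (fun s => h s ^ 2 + deriv h s ^ 2) :=
    h.memLp.integrable_sq.add h.acl2.2.integrable_sq
  have hi3 : Integrable ((Set.Icc t (t + 1)).indicator (1 : ℝ → ℝ)) :=
    (integrable_indicator_iff measurableSet_Icc).2
      (integrableOn_const (C := (1 : ℝ)) (by simp) (by simp))
  rw [integral_add hi hi3, integral_indicator measurableSet_Icc]
  simp [Measure.real]

end HU

/-! ### The path space of the Ornstein–Uhlenbeck process -/

/-- Underlying vector space of `UPath`: continuous `ω` with `|ω(t)| / log |t| → 0` as `|t| → ∞`. -/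
def UPathSubmodule : Submodule ℝ (ℝ → ℝ) where
  carrier := {ω | Continuous ω ∧ Tendsto (fun t => |ω t| / Real.log |t|) (cocompact ℝ) (𝓝 0)}
  add_mem' := by
    rintro f g ⟨hf, hf'⟩ ⟨hg, hg'⟩
    refine ⟨hf.add hg, ?_⟩
    have h1 : Tendsto (fun t => f t / Real.log |t|) (cocompact ℝ) (𝓝 0) :=
      (tendsto_zero_iff_abs_tendsto_zero _).2
        ((tendsto_zero_iff_abs_tendsto_zero _).1 hf' |>.congr fun t => by simp [abs_div])
    have h2 : Tendsto (fun t => g t / Real.log |t|) (cocompact ℝ) (𝓝 0) :=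
      (tendsto_zero_iff_abs_tendsto_zero _).2
        ((tendsto_zero_iff_abs_tendsto_zero _).1 hg' |>.congr fun t => by simp [abs_div])
    have h3 : Tendsto (fun t => abs (f t / Real.log |t| + g t / Real.log |t|))
        (cocompact ℝ) (𝓝 0) := by simpa using (h1.add h2).abs
    rw [tendsto_zero_iff_abs_tendsto_zero]
    refine h3.congr fun t => ?_
    rw [← add_div]
    simp [abs_div]
  zero_mem' := ⟨continuous_zero, by simp⟩
  smul_mem' := by
    rintro c f ⟨hf, hf'⟩
    refine ⟨hf.const_smul c, ?_⟩
    have := hf'.const_mul |c|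
    rw [mul_zero] at this
    refine this.congr fun t => ?_
    simp [abs_mul, mul_div_assoc]

/-- The Banach space `𝒰` of continuous `ω : ℝ → ℝ` with `|ω(t)| / log |t| → 0` as `|t| → ∞`, with
norm `sup_t |ω(t)| / log (e + |t|)`. -/
def UPath : Type := UPathSubmodule

namespace UPath

instance : AddCommGroup UPath := inferInstanceAs (AddCommGroup UPathSubmodule)
instance : Module ℝ UPath := inferInstanceAs (Module ℝ UPathSubmodule)

instance : FunLike UPath ℝ ℝ where
  coe g := g.1
  coe_injective _ _ h := Subtype.ext h

lemma one_le_weight (t : ℝ) : 1 ≤ Real.log (Real.exp 1 + |t|) := by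
  rw [Real.le_log_iff_exp_le (by positivity)]
  linarith [abs_nonneg t]

lemma weight_ne_zero (t : ℝ) : Real.log (Real.exp 1 + |t|) ≠ 0 := by
  linarith [one_le_weight t]

/-- `ω ↦ ω / log (e + |·|)`, a linear map into the continuous functions vanishing at infinity. -/
def toC0 : UPath →ₗ[ℝ] C₀(ℝ, ℝ) where
  toFun ω :=
    { toFun := fun t => ω t / Real.log (Real.exp 1 + |t|)
      continuous_toFun := by
        refine Continuous.div ω.2.1 ?_ weight_ne_zero
        exact Continuous.log (by fun_prop) fun t => by positivity
      zero_at_infty' := by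
        rw [tendsto_zero_iff_abs_tendsto_zero]
        refine tendsto_of_tendsto_of_tendsto_of_le_of_le' tendsto_const_nhds ω.2.2
          (.of_forall fun _ => abs_nonneg _) ?_
        have h := (tendsto_norm_cocompact_atTop (E := ℝ)).eventually_gt_atTop 1
        filter_upwards [h] with t ht
        rw [Real.norm_eq_abs] at ht
        simp only [Function.comp_apply, abs_div]
        have hl : 0 < Real.log |t| := Real.log_pos ht
        have hle : Real.log |t| ≤ |Real.log (Real.exp 1 + |t|)| := by
          refine le_trans ?_ (le_abs_self _)
          refine Real.log_le_log (zero_lt_one.trans ht) ?_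
          linarith [Real.exp_pos 1]
        exact div_le_div_of_nonneg_left (abs_nonneg _) hl hle }
  map_add' f g := by
    ext t
    exact add_div _ _ _
  map_smul' c f := by
    ext t
    exact mul_div_assoc _ _ _

lemma toC0_apply (ω : UPath) (t : ℝ) : toC0 ω t = ω t / Real.log (Real.exp 1 + |t|) := rfl

lemma toC0_injective : Function.Injective toC0 := fun f g h => by
  refine DFunLike.ext _ _ fun t => ?_
  have := DFunLike.congr_fun h t
  rw [toC0_apply, toC0_apply] at this
  exact (div_left_inj' (weight_ne_zero t)).1 this

instance : NormedAddCommGroup UPath :=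
  NormedAddCommGroup.induced UPath C₀(ℝ, ℝ) toC0 toC0_injective
instance : NormedSpace ℝ UPath := NormedSpace.induced ℝ UPath C₀(ℝ, ℝ) toC0

lemma norm_def (ω : UPath) : ‖ω‖ = ⨆ t, |ω t| / Real.log (Real.exp 1 + |t|) := by
  have h : ‖ω‖ = ‖(toC0 ω).toBCF‖ := rfl
  rw [h, BoundedContinuousFunction.norm_eq_iSup_norm]
  refine iSup_congr fun t => ?_
  change ‖ω t / Real.log (Real.exp 1 + |t|)‖ = _
  rw [norm_div, Real.norm_eq_abs, Real.norm_eq_abs,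
    abs_of_pos (a := Real.log _) (by linarith [one_le_weight t])]

instance : MeasurableSpace UPath := borel UPath
instance : BorelSpace UPath := ⟨rfl⟩

end UPath

/-- The inclusion of `H^U` in `𝒰`. -/
def incl : HU →ₗ[ℝ] UPath where
  toFun h := ⟨h, h.acl2.continuous, by
    obtain ⟨C, hC⟩ := h.exists_bound
    have hlog : Tendsto (fun t : ℝ => Real.log |t|) (cocompact ℝ) atTop :=
      Real.tendsto_log_atTop.comp (tendsto_norm_cocompact_atTop (E := ℝ))
    refine tendsto_of_tendsto_of_tendsto_of_le_of_le' tendsto_const_nhds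
      (hlog.const_div_atTop C) ?_ ?_
    · filter_upwards [hlog.eventually_gt_atTop 0] with t ht
      positivity
    · filter_upwards [hlog.eventually_gt_atTop 0] with t ht
      exact div_le_div_of_nonneg_right (hC t) ht.le⟩
  map_add' _ _ := rfl
  map_smul' _ _ := rfl

/-! ### Abstract Wiener spaces -/

section AbstractWiener

variable {H E : Type*} [NormedAddCommGroup H] [InnerProductSpace ℝ H]
  [NormedAddCommGroup E] [NormedSpace ℝ E] [MeasurableSpace E]

/-- `h` is the element `h_{x*}` of `H`, i.e. `(k, h)_H = ⟨k, x*⟩` for all `k ∈ H`, where `H` is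
embedded in `E` by `i`. -/
def Represents (i : H →ₗ[ℝ] E) (x : StrongDual ℝ E) (h : H) : Prop :=
  ∀ k : H, ⟪k, h⟫ = x (i k)

/-- The condition on the measure in an abstract Wiener space `(H, E, W)`: each `x* ∈ E*` is a
centered Gaussian variable of variance `‖h_{x*}‖²` under `W`. -/
def IsWienerMeasure (i : H →ₗ[ℝ] E) (W : Measure E) : Prop :=
  ∀ (x : StrongDual ℝ E) (h : H), Represents i x h →
    W.map x = gaussianReal 0 (‖h‖₊ ^ 2)

/-- `I` is the Paley–Wiener isometry `H → L²(W)`: `I(h_{x*}) = ⟨·, x*⟩`. -/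
def IsPaleyWiener (i : H →ₗ[ℝ] E) (W : Measure E) (I : H →ₗᵢ[ℝ] Lp ℝ 2 W) : Prop :=
  ∀ (x : StrongDual ℝ E) (h : H), Represents i x h → I h =ᵐ[W] x

/-- `T` is a version of the transformation `T_O` of `E` associated with the orthogonal
transformation `O` of `H`: `I(h) ∘ T = I(Oᵀ h)` almost surely, for every `h ∈ H`. As `I(h)` is a
class of functions modulo null sets, the identity is asserted for each representative `f`. -/
def IsInduced {W : Measure E} (I : H →ₗᵢ[ℝ] Lp ℝ 2 W) (O : H ≃ₗᵢ[ℝ] H) (T : E → E) : Prop :=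
  Measurable T ∧ ∀ (h : H) (f : E → ℝ), f =ᵐ[W] I h → f ∘ T =ᵐ[W] I (O.symm h)

end AbstractWiener

/-- `W` is the law of the standard stationary Ornstein–Uhlenbeck process: under `W` the coordinate
process is a centered Gaussian process with covariance `e^{-|t - s| / 2}`. -/
def IsOrnsteinUhlenbeckLaw (W : Measure UPath) : Prop :=
  IsGaussianProcess (fun (t : ℝ) (ω : UPath) => ω t) W ∧ (∀ t : ℝ, ∫ ω : UPath, ω t ∂W = 0) ∧
    ∀ s t : ℝ, ∫ ω : UPath, ω s * ω t ∂W = Real.exp (-|t - s| / 2)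

/-! ### Fourier multipliers and the Jeulin–Yor map -/

/-- The symbol `e^{-2 i u arctan (2 λ)}`. -/
def symbol (u l : ℝ) : ℂ := Complex.exp (-2 * Complex.I * u * (Real.arctan (2 * l) : ℝ))

/-- `A` acts on `H^U` as the Fourier multiplier `m(λ)` for the Fourier transform
`ĥ(λ) = ∫ e^{-i λ x} h(x) dx`, so that `λ = 2 π ξ` in terms of the frequency `ξ` of `HU.fourier`. -/
def IsFourierMultiplier (m : ℝ → ℂ) (A : HU → HU) : Prop :=
  ∀ h : HU, ∀ᵐ ξ : ℝ, (A h).fourier ξ = m (2 * Real.pi * ξ) * h.fourier ξ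

/-- `O` is the Jeulin–Yor transformation `(O g)(t) = g(t) - ∫₀ᵗ g(s) / s ds`. -/
def IsJeulinYor (O : H10 → H10) : Prop :=
  ∀ (g : H10) (t : ℝ), 0 ≤ t → O g t = g t - ∫ s in (0 : ℝ)..t, g s / s

/-- `F` is the map `(F g)(t) = e^{-t/2} g(e^t)`. -/
def IsOUTransport (F : H10 → HU) : Prop :=
  ∀ (g : H10) (t : ℝ), F g t = Real.exp (-t / 2) * g (Real.exp t)

end OUFlow

end

open OUFlow

/-!
The substitution behind the proof is `D h = h' + h / 2`. The cross term of `‖D h‖²` is the integral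
of `(h²)' / 2`, which vanishes, so `D` is an isometry of `H^U` into `L²(ℝ)`; it is onto, because
`w(t) = ∫_{-∞}^t e^{(r - t) / 2} φ(r) dr` solves `D w = φ` (`HU.drift`). This makes `H^U` complete
and exhibits evaluation at `t` as the inner product with an element `HU.evalRep t`, the inner
product of two such elements being `e^{-|t - s| / 2}`.

On the Fourier side `D` is multiplication by `1/2 + iλ` (`HU.fourierReal_drift`), so a multiplier on
`H^U` is the same as a multiplier on `L²(ℝ)`. The symbols `e^{-2iu arctan(2λ)}` have modulus `1` and
Hermitian symmetry, hence give orthogonal transformations of the real space (`flow`). Matrix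
coefficients are integrals of the symbol against an integrable density; the substitution
`λ = tan θ / 2` makes them Fourier transforms in `u`, and the Riemann–Lebesgue lemma gives their
decay (`tendsto_inner_flow`).

If `F` is the logarithmic time change, then `D (F g) = e^{t/2} ġ(e^t)`, so `F` is isometric, and
`g ↦ ∫₀ᵗ g(s) / s ds` becomes `D⁻¹`. The symbol at `u = 1` is `1 / (1/2 + iλ) - 1`, that is
`𝒮 1 = D⁻¹ - 1`, which is minus the Jeulin–Yor transformation in logarithmic time
(`flow_one_eq_neg_transport`).

On path space, the Paley–Wiener map `I` is the isometric extension of `h_x ↦ x`, and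
`∫ e^{iI(h)} dW = e^{-‖h‖² / 2}` by density. For an orthogonal `O` the process
`(I(Oᵀ h_q))_q`, indexed by the rationals, therefore has the same law as the coordinates
`(ω(q))_q`. As the path space is Polish, restriction to the rationals identifies it with a Borel
subset of `ℝ^ℚ` (Lusin–Souslin), so the process almost surely comes from a path; this is the
transformation induced by `O` (`exists_isInduced`), and it preserves `W`. No continuity
criterion for Gaussian processes is needed.

For ergodicity, let `A` be invariant under `S u`. Then `∫_A e^{iI(h)} dW = ∫_A e^{iI(𝒮^{-nu} h)} dW`
for all `n`. By decay of the matrix coefficients the variables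
`e^{iI(𝒮^{-nu} h)} - e^{-‖h‖² / 2}` are asymptotically orthogonal, hence weakly null, so that
`∫_A e^{iI(h)} dW = W(A) e^{-‖h‖² / 2}`. The
restriction of `W` to `A` thus has the characteristic function of `W(A) W`, which forces
`W(A) = W(A)²`.
-/

noncomputable section

namespace OUFlow

/-! ### Absolutely continuous functions on the line -/

lemma absolutelyContinuousOnInterval_primitive {φ : ℝ → ℝ} (hφ : LocallyIntegrable φ) (a b : ℝ) :
    AbsolutelyContinuousOnInterval (fun x => ∫ t in (0 : ℝ)..x, φ t) a b := by
  have hab : (0 : ℝ) ≤ |a| + |b| := by positivity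
  have h : IntervalIntegrable φ volume (-(|a| + |b|)) (|a| + |b|) :=
    (hφ.integrableOn_isCompact isCompact_uIcc).intervalIntegrable
  refine (h.absolutelyContinuousOnInterval_intervalIntegral (c := 0) ?_).mono ?_
  · rw [Set.uIcc_of_le (by linarith)]
    exact ⟨by linarith, hab⟩
  · refine Set.uIcc_subset_uIcc ?_ ?_ <;> rw [Set.uIcc_of_le (by linarith)]
    · exact ⟨by linarith [neg_abs_le a, abs_nonneg b], by linarith [le_abs_self a, abs_nonneg b]⟩
    · exact ⟨by linarith [neg_abs_le b, abs_nonneg a], by linarith [le_abs_self b, abs_nonneg a]⟩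

lemma ae_hasDerivAt_primitive {φ : ℝ → ℝ} (hφ : LocallyIntegrable φ) :
    ∀ᵐ x, HasDerivAt (fun x => ∫ t in (0 : ℝ)..x, φ t) (φ x) x := by
  filter_upwards [LocallyIntegrable.ae_hasDerivAt_integral hφ] with x hx using hx 0

lemma tendsto_atTop_of_integrable_deriv {f : ℝ → ℝ}
    (hf : ∀ a b, AbsolutelyContinuousOnInterval f a b)
    (hi : Integrable f) (hd : Integrable (deriv f)) : Tendsto f atTop (𝓝 0) := by
  have h1 := (intervalIntegral_tendsto_integral_Ioi 0 hd.integrableOn tendsto_id).const_add (f 0)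
  have h2 : Tendsto f atTop (𝓝 (f 0 + ∫ x in Set.Ioi 0, deriv f x)) := by
    refine h1.congr fun t => ?_
    rw [id, (hf 0 t).integral_deriv_eq_sub]
    ring
  have h3 : IntegrableAtFilter f atTop volume := hi.integrableAtFilter _
  rwa [h3.eq_zero_of_tendsto (fun s hs => ?_) h2] at h2
  obtain ⟨b, hb⟩ := mem_atTop_sets.1 hs
  rw [← top_le_iff, ← Real.volume_Ici (a := b)]
  exact measure_mono hb

lemma tendsto_atBot_of_integrable_deriv {f : ℝ → ℝ}
    (hf : ∀ a b, AbsolutelyContinuousOnInterval f a b)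
    (hi : Integrable f) (hd : Integrable (deriv f)) : Tendsto f atBot (𝓝 0) := by
  have h1 := (intervalIntegral_tendsto_integral_Iic 0 hd.integrableOn tendsto_id).const_sub (f 0)
  have h2 : Tendsto f atBot (𝓝 (f 0 - ∫ x in Set.Iic 0, deriv f x)) := by
    refine h1.congr fun t => ?_
    rw [id, (hf t 0).integral_deriv_eq_sub]
    ring
  have h3 : IntegrableAtFilter f atBot volume := hi.integrableAtFilter _
  rwa [h3.eq_zero_of_tendsto (fun s hs => ?_) h2] at h2
  obtain ⟨b, hb⟩ := mem_atBot_sets.1 hs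
  rw [← top_le_iff, ← Real.volume_Iic (a := b)]
  exact measure_mono hb

lemma integral_deriv_eq_zero_of_integrable {f : ℝ → ℝ}
    (hf : ∀ a b, AbsolutelyContinuousOnInterval f a b)
    (hi : Integrable f) (hd : Integrable (deriv f)) : ∫ t, deriv f t = 0 := by
  have h1 := intervalIntegral_tendsto_integral hd tendsto_neg_atTop_atBot tendsto_id
  have h2 := (tendsto_atTop_of_integrable_deriv hf hi hd).sub
    ((tendsto_atBot_of_integrable_deriv hf hi hd).comp tendsto_neg_atTop_atBot)
  rw [sub_zero] at h2
  refine tendsto_nhds_unique h1 (h2.congr fun t => ?_)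
  rw [(hf _ _).integral_deriv_eq_sub]
  rfl

/-! ### The first-order operator `h ↦ h' + h / 2` on `H^U` -/

namespace HU

lemma ae_differentiableAt (h : HU) : ∀ᵐ x, DifferentiableAt ℝ h x := h.acl2.ae_differentiableAt

lemma memLp_drift (h : HU) : MemLp (fun t => deriv h t + 1 / 2 * h t) 2 volume :=
  h.acl2.2.add (h.memLp.const_mul (1 / 2))

/-- `h h'` is the derivative of `h² / 2`, and `h` vanishes at infinity. -/
lemma integral_mul_deriv_self (h : HU) : ∫ t, h t * deriv h t = 0 := by
  have hd : deriv (fun t => h t * h t) =ᵐ[volume] fun t => 2 * (h t * deriv h t) := by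
    filter_upwards [h.ae_differentiableAt] with t ht
    rw [deriv_fun_mul ht ht]
    ring
  have hi : Integrable (fun t => h t * deriv h t) := h.memLp.integrable_mul h.acl2.2
  have := integral_deriv_eq_zero_of_integrable (f := fun t => h t * h t)
    (fun a b => (h.acl2.1 a b).fun_mul (h.acl2.1 a b)) (h.memLp.integrable_mul h.memLp)
    ((integrable_congr hd).2 (hi.const_mul 2))
  rw [integral_congr_ae hd, integral_const_mul] at this
  linarith

/-- The isometric embedding `h ↦ h' + h / 2` of `H^U` into `L²(ℝ)`: the cross term of the norm is
the integral of `(h²)' / 2`, which vanishes. -/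
def driftₗᵢ : HU →ₗᵢ[ℝ] Lp ℝ 2 (volume : Measure ℝ) where
  toFun h := h.memLp_drift.toLp _
  map_add' f g := by
    rw [← MemLp.toLp_add]
    refine MemLp.toLp_congr _ _ ?_
    filter_upwards [ACL2.deriv_add_ae f.acl2 g.acl2] with t ht
    rw [coe_add, ht]
    simp only [Pi.add_apply]
    ring
  map_smul' c f := by
    rw [RingHom.id_apply, ← MemLp.toLp_const_smul]
    refine MemLp.toLp_congr _ _ (.of_forall fun t => ?_)
    rw [coe_smul, ACL2.deriv_smul_eq]
    simp only [Pi.smul_apply, smul_eq_mul]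
    ring
  norm_map' h := by
    have h1 : ‖(h.memLp_drift.toLp _ : Lp ℝ 2 (volume : Measure ℝ))‖ ^ 2 = ‖h‖ ^ 2 := by
      rw [← real_inner_self_eq_norm_sq, ← real_inner_self_eq_norm_sq, L2.inner_def, inner_def]
      have h2 : (fun t => ⟪(h.memLp_drift.toLp _ : Lp ℝ 2 (volume : Measure ℝ)) t,
          (h.memLp_drift.toLp _ : Lp ℝ 2 (volume : Measure ℝ)) t⟫) =ᵐ[volume]
          fun t => (1 / 4 * (h t * h t) + deriv h t * deriv h t) + h t * deriv h t := by
        filter_upwards [h.memLp_drift.coeFn_toLp] with t ht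
        rw [ht]
        simp only [RCLike.inner_apply, conj_trivial]
        ring
      have h3 : Integrable (fun t => h t * deriv h t) := h.memLp.integrable_mul h.acl2.2
      rw [integral_congr_ae h2, integral_add (integrable_inner h h) h3, integral_mul_deriv_self,
        add_zero]
    exact (sq_eq_sq₀ (norm_nonneg _) (norm_nonneg _)).1 h1

/-- The reproducing kernel of `H^U`, seen in `L²(ℝ)`: the Green function
`r ↦ 1_{r ≤ t} e^{(r - t) / 2}` of `h ↦ h' + h / 2`. -/
def greenFun (t r : ℝ) : ℝ := (Set.Iic t).indicator (fun r => Real.exp ((r - t) / 2)) r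

lemma measurable_greenFun (t : ℝ) : Measurable (greenFun t) :=
  Measurable.indicator (by fun_prop) measurableSet_Iic

lemma integral_greenFun_mul (s t : ℝ) :
    ∫ r, greenFun s r * greenFun t r = Real.exp (-|t - s| / 2) := by
  have h1 : (fun r => greenFun s r * greenFun t r) =
      (Set.Iic (min s t)).indicator fun r => Real.exp (-(s + t) / 2) * Real.exp r := by
    funext r
    simp only [greenFun, Set.indicator_apply, Set.mem_Iic, le_min_iff]
    by_cases h1 : r ≤ s <;> by_cases h2 : r ≤ t <;> simp only [h1, h2, if_true, if_false, and_self,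
      and_true, and_false, mul_zero, zero_mul]
    rw [← Real.exp_add, ← Real.exp_add]
    ring_nf
  rw [h1, integral_indicator measurableSet_Iic, integral_const_mul, integral_exp_Iic,
    ← Real.exp_add]
  congr 1
  rw [min_def, abs_eq_max_neg, max_def]
  split_ifs <;> linarith

lemma integrable_greenFun_sq (t : ℝ) : Integrable (fun r => greenFun t r ^ 2) := by
  -- otherwise the integral of this function, which is positive, would be `0` by convention
  by_contra h
  have h1 := integral_undef h
  have h2 := integral_greenFun_mul t t
  simp only [← sq] at h2
  rw [h1] at h2
  exact (Real.exp_pos _).ne h2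

lemma memLp_greenFun (t : ℝ) : MemLp (greenFun t) 2 volume :=
  (memLp_two_iff_integrable_sq (measurable_greenFun t).aestronglyMeasurable).2
    (integrable_greenFun_sq t)

/-- `greenFun t` as an element of `L²(ℝ)`. -/
def green (t : ℝ) : Lp ℝ 2 (volume : Measure ℝ) := (memLp_greenFun t).toLp _

lemma inner_green (t : ℝ) (φ : Lp ℝ 2 (volume : Measure ℝ)) :
    ⟪green t, φ⟫ = ∫ r, greenFun t r * φ r := by
  rw [L2.inner_def]
  refine integral_congr_ae ?_
  filter_upwards [(memLp_greenFun t).coeFn_toLp] with r hr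
  rw [green, hr]
  simp [mul_comm]

lemma inner_green_green (s t : ℝ) : ⟪green s, green t⟫ = Real.exp (-|t - s| / 2) := by
  rw [inner_green, ← integral_greenFun_mul]
  refine integral_congr_ae ?_
  filter_upwards [(memLp_greenFun t).coeFn_toLp] with r hr
  rw [green, hr]

lemma norm_green (t : ℝ) : ‖green t‖ = 1 := by
  have h := inner_green_green t t
  rw [real_inner_self_eq_norm_sq, sub_self, abs_zero, neg_zero, zero_div, Real.exp_zero] at h
  exact (pow_eq_one_iff_of_nonneg (norm_nonneg _) two_ne_zero).1 h

/-- The solution `t ↦ ∫_{-∞}^t e^{(r - t) / 2} φ(r) dr` of `w' + w / 2 = φ` that vanishes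
at `-∞`. -/
def driftSol (φ : Lp ℝ 2 (volume : Measure ℝ)) (t : ℝ) : ℝ := ⟪green t, φ⟫

lemma integrableOn_exp_mul (φ : Lp ℝ 2 (volume : Measure ℝ)) (t : ℝ) :
    IntegrableOn (fun r => Real.exp (r / 2) * φ r) (Set.Iic t) := by
  have h := ((memLp_greenFun t).integrable_mul (Lp.memLp φ)).const_mul (Real.exp (t / 2))
  refine (h.integrableOn (s := Set.Iic t)).congr_fun (fun r hr => ?_) measurableSet_Iic
  simp only [Pi.mul_apply, greenFun, Set.indicator_of_mem hr]
  rw [← mul_assoc, ← Real.exp_add]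
  ring_nf

lemma driftSol_eq (φ : Lp ℝ 2 (volume : Measure ℝ)) (t : ℝ) :
    driftSol φ t = Real.exp (-t / 2) * ∫ r in Set.Iic t, Real.exp (r / 2) * φ r := by
  rw [driftSol, inner_green, ← integral_const_mul, ← integral_indicator measurableSet_Iic]
  congr 1
  funext r
  by_cases hr : r ∈ Set.Iic t
  · simp only [greenFun, Set.indicator_of_mem hr]
    rw [← mul_assoc, ← Real.exp_add]
    ring_nf
  · simp [greenFun, Set.indicator_of_notMem hr]

lemma driftSol_eq' (φ : Lp ℝ 2 (volume : Measure ℝ)) (t : ℝ) :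
    driftSol φ t = Real.exp (-t / 2) * ((∫ r in Set.Iic 0, Real.exp (r / 2) * φ r) +
      ∫ r in (0 : ℝ)..t, Real.exp (r / 2) * φ r) := by
  rw [driftSol_eq, ← intervalIntegral.integral_Iic_sub_Iic (integrableOn_exp_mul φ 0)
    (integrableOn_exp_mul φ t)]
  ring_nf

lemma locallyIntegrable_exp_mul (φ : Lp ℝ 2 (volume : Measure ℝ)) :
    LocallyIntegrable (fun r => Real.exp (r / 2) * φ r) := by
  have h := (Lp.memLp φ).locallyIntegrable (by norm_num)
  have h1 := (locallyIntegrableOn_univ.2 h).continuousOn_mul (g := fun r => Real.exp (r / 2))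
    (by fun_prop) isOpen_univ.isLocallyClosed
  exact locallyIntegrableOn_univ.1 h1

lemma absolutelyContinuousOnInterval_driftSol (φ : Lp ℝ 2 (volume : Measure ℝ)) (a b : ℝ) :
    AbsolutelyContinuousOnInterval (driftSol φ) a b := by
  have h1 : AbsolutelyContinuousOnInterval (fun t : ℝ => Real.exp (-t / 2)) a b :=
    ContDiffOn.absolutelyContinuousOnInterval (by fun_prop)
  have h2 : AbsolutelyContinuousOnInterval
      (fun _ : ℝ => ∫ r in Set.Iic 0, Real.exp (r / 2) * φ r) a b :=
    (LipschitzWith.const _).lipschitzOnWith.absolutelyContinuousOnInterval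
  have := h1.fun_mul (h2.add
    (absolutelyContinuousOnInterval_primitive (locallyIntegrable_exp_mul φ) a b))
  convert this using 1
  funext t
  exact driftSol_eq' φ t

lemma ae_hasDerivAt_driftSol (φ : Lp ℝ 2 (volume : Measure ℝ)) :
    ∀ᵐ t, HasDerivAt (driftSol φ) (φ t - 1 / 2 * driftSol φ t) t := by
  filter_upwards [ae_hasDerivAt_primitive (locallyIntegrable_exp_mul φ)] with t ht
  have h1 : HasDerivAt (fun t : ℝ => Real.exp (-t / 2)) (Real.exp (-t / 2) * (-1 / 2)) t :=
    ((hasDerivAt_id t).neg.div_const 2).exp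
  have h2 := h1.fun_mul (ht.const_add (∫ r in Set.Iic 0, Real.exp (r / 2) * φ r))
  refine (h2.congr_of_eventuallyEq (.of_forall (driftSol_eq' φ))).congr_deriv ?_
  have h3 : Real.exp (-t / 2) * Real.exp (t / 2) = 1 := by
    rw [← Real.exp_add, ← Real.exp_zero]
    ring_nf
  rw [driftSol_eq', ← mul_assoc (Real.exp (-t / 2)), h3]
  ring

lemma abs_driftSol_le (φ : Lp ℝ 2 (volume : Measure ℝ)) (t : ℝ) : |driftSol φ t| ≤ ‖φ‖ := by
  simpa [norm_green, driftSol] using abs_real_inner_le_norm (green t) φ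

lemma continuous_driftSol (φ : Lp ℝ 2 (volume : Measure ℝ)) : Continuous (driftSol φ) := by
  rw [continuous_iff_continuousAt]
  intro x
  refine (absolutelyContinuousOnInterval_driftSol φ (x - 1) (x + 1)).continuousOn.continuousAt ?_
  rw [Set.uIcc_of_le (by linarith)]
  exact Icc_mem_nhds (by linarith) (by linarith)

/-- The solution is square integrable: `(w²)' = 2 w φ - w² ≤ 2 φ² - w² / 2`, and `w` is bounded. -/
lemma memLp_driftSol (φ : Lp ℝ 2 (volume : Measure ℝ)) : MemLp (driftSol φ) 2 volume := by
  have hc := continuous_driftSol φ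
  have hφ : Integrable (fun t => φ t ^ 2) := (Lp.memLp φ).integrable_sq
  refine (memLp_two_iff_integrable_sq hc.aestronglyMeasurable).2 ?_
  refine integrable_of_intervalIntegral_norm_bounded (l := atTop) (a := fun x : ℝ => -x) (b := id)
    (4 * (∫ t, φ t ^ 2) + 2 * ‖φ‖ ^ 2)
    (fun x => (hc.pow 2).integrableOn_Ioc) tendsto_neg_atTop_atBot tendsto_id ?_
  filter_upwards [eventually_ge_atTop 0] with x hx
  have hac := absolutelyContinuousOnInterval_driftSol φ (-x) x
  have h1 := (hac.fun_mul hac).integral_deriv_eq_sub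
  have hi := (hac.fun_mul hac).intervalIntegrable_deriv
  have hw : IntervalIntegrable (fun t => driftSol φ t ^ 2) volume (-x) x :=
    (hc.pow 2).intervalIntegrable _ _
  have h2 : (∫ t in (-x)..x, deriv (fun t => driftSol φ t * driftSol φ t) t) ≤
      ∫ t in (-x)..x, (2 * φ t ^ 2 - 1 / 2 * driftSol φ t ^ 2) := by
    refine intervalIntegral.integral_mono_ae (by linarith) hi
      ((hφ.intervalIntegrable.const_mul 2).sub (hw.const_mul (1 / 2))) ?_
    filter_upwards [ae_hasDerivAt_driftSol φ] with t ht
    rw [(ht.fun_mul ht).deriv]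
    nlinarith [sq_nonneg (2 * φ t - driftSol φ t)]
  rw [intervalIntegral.integral_sub (hφ.intervalIntegrable.const_mul 2) (hw.const_mul (1 / 2)),
    intervalIntegral.integral_const_mul, intervalIntegral.integral_const_mul, h1] at h2
  have h3 : ∫ t in (-x)..x, φ t ^ 2 ≤ ∫ t, φ t ^ 2 := by
    rw [intervalIntegral.integral_of_le (by linarith)]
    exact setIntegral_le_integral hφ (.of_forall fun _ => sq_nonneg _)
  have h4 : driftSol φ (-x) * driftSol φ (-x) ≤ ‖φ‖ ^ 2 := by
    rw [← sq]
    exact sq_le_sq.2 (by simpa using abs_driftSol_le φ (-x))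
  have h5 : ∀ t, ‖driftSol φ t ^ 2‖ = driftSol φ t ^ 2 := fun t => by simp
  simp only [h5, id]
  nlinarith [mul_self_nonneg (driftSol φ x)]

/-- `driftSol φ` as an element of `H^U`. -/
def ofDrift (φ : Lp ℝ 2 (volume : Measure ℝ)) : HU :=
  ⟨driftSol φ, memLp_driftSol φ, absolutelyContinuousOnInterval_driftSol φ, by
    have h : deriv (driftSol φ) =ᵐ[volume] fun t => φ t - 1 / 2 * driftSol φ t := by
      filter_upwards [ae_hasDerivAt_driftSol φ] with t ht using ht.deriv
    exact (memLp_congr_ae h).2 ((Lp.memLp φ).sub ((memLp_driftSol φ).const_mul (1 / 2)))⟩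

lemma ofDrift_apply (φ : Lp ℝ 2 (volume : Measure ℝ)) (t : ℝ) : ofDrift φ t = ⟪green t, φ⟫ := rfl

lemma driftₗᵢ_ofDrift (φ : Lp ℝ 2 (volume : Measure ℝ)) : driftₗᵢ (ofDrift φ) = φ := by
  refine Lp.ext ?_
  filter_upwards [(ofDrift φ).memLp_drift.coeFn_toLp, ae_hasDerivAt_driftSol φ] with t h1 h2
  refine h1.trans ?_
  have h3 : deriv (ofDrift φ) t = φ t - 1 / 2 * ofDrift φ t := h2.deriv
  rw [h3]
  ring

/-- The isometric isomorphism `h ↦ h' + h / 2` of `H^U` onto `L²(ℝ)`. -/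
def drift : HU ≃ₗᵢ[ℝ] Lp ℝ 2 (volume : Measure ℝ) :=
  LinearIsometryEquiv.ofSurjective driftₗᵢ fun φ => ⟨ofDrift φ, driftₗᵢ_ofDrift φ⟩

lemma coeFn_drift (h : HU) : drift h =ᵐ[volume] fun t => deriv h t + 1 / 2 * h t :=
  h.memLp_drift.coeFn_toLp

lemma drift_symm (φ : Lp ℝ 2 (volume : Measure ℝ)) : drift.symm φ = ofDrift φ := by
  rw [LinearIsometryEquiv.symm_apply_eq]
  exact (driftₗᵢ_ofDrift φ).symm

instance : CompleteSpace HU :=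
  (drift.isometry.isUniformInducing.completeSpace_congr drift.surjective).2 inferInstance

/-- The element `h` of `H^U`, seen in `L²(ℝ)`. -/
def toL2 (h : HU) : Lp ℝ 2 (volume : Measure ℝ) := h.memLp.toLp h

/-- The element of `H^U` representing evaluation at `t`. -/
def evalRep (t : ℝ) : HU := drift.symm (green t)

lemma inner_evalRep (h : HU) (t : ℝ) : ⟪h, evalRep t⟫ = h t := by
  obtain ⟨φ, rfl⟩ := drift.symm.surjective h
  rw [evalRep, drift.symm.inner_map_map, drift_symm, ofDrift_apply, real_inner_comm]

lemma inner_evalRep_evalRep (s t : ℝ) : ⟪evalRep s, evalRep t⟫ = Real.exp (-|t - s| / 2) := by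
  rw [evalRep, evalRep, drift.symm.inner_map_map, inner_green_green]

lemma abs_apply_le (h : HU) (t : ℝ) : |h t| ≤ ‖h‖ := by
  have h1 := abs_real_inner_le_norm h (evalRep t)
  rw [inner_evalRep, evalRep, LinearIsometryEquiv.norm_map, norm_green, mul_one] at h1
  exact h1

end HU

/-! ### The logarithmic time change between `H¹₀` and `H^U` -/

lemma ae_comp_exp {p : ℝ → Prop} (h : ∀ᵐ s, p s) : ∀ᵐ t, p (Real.exp t) := by
  have h1 : volume (Real.log '' ({s | ¬ p s} ∩ Set.Ioi 0)) = 0 := by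
    refine addHaar_image_eq_zero_of_differentiableOn_of_addHaar_eq_zero volume ?_ ?_
    · exact fun x hx => (Real.differentiableAt_log hx.2.ne').differentiableWithinAt
    · exact measure_mono_null Set.inter_subset_left h
  refine measure_mono_null (fun t ht => ?_) h1
  exact ⟨Real.exp t, ⟨ht, Real.exp_pos t⟩, Real.log_exp t⟩

lemma ae_of_ae_comp_exp {p : ℝ → Prop} (h : ∀ᵐ t, p (Real.exp t)) : ∀ᵐ s, 0 < s → p s := by
  have h1 : volume (Real.exp '' {t | ¬ p (Real.exp t)}) = 0 :=
    addHaar_image_eq_zero_of_differentiableOn_of_addHaar_eq_zero volume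
      Real.differentiable_exp.differentiableOn h
  refine measure_mono_null (fun s hs => ?_) h1
  simp only [Set.mem_compl_iff, Set.mem_ofPred_eq, Classical.not_imp] at hs
  refine ⟨Real.log s, ?_, Real.exp_log hs.1⟩
  simp only [Set.mem_ofPred_eq, Real.exp_log hs.1]
  exact hs.2

lemma setIntegral_exp_image (s : Set ℝ) (hs : MeasurableSet s) (f : ℝ → ℝ) :
    ∫ x in Real.exp '' s, f x = ∫ t in s, Real.exp t * f (Real.exp t) := by
  rw [integral_image_eq_integral_abs_deriv_smul hs
    (fun x _ => (Real.hasDerivAt_exp x).hasDerivWithinAt) Real.exp_injective.injOn]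
  simp [Real.abs_exp]

lemma integral_Ioi_eq_integral_exp (f : ℝ → ℝ) :
    ∫ x in Set.Ioi 0, f x = ∫ t, Real.exp t * f (Real.exp t) := by
  have h := setIntegral_exp_image Set.univ MeasurableSet.univ f
  rwa [Set.image_univ, Real.range_exp, setIntegral_univ] at h

lemma integrableOn_Ioi_iff_integrable_exp (f : ℝ → ℝ) :
    IntegrableOn f (Set.Ioi 0) ↔ Integrable fun t => Real.exp t * f (Real.exp t) := by
  rw [← Real.range_exp, ← Set.image_univ, integrableOn_image_iff_integrableOn_abs_deriv_smul
    MeasurableSet.univ (fun x _ => (Real.hasDerivAt_exp x).hasDerivWithinAt)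
    Real.exp_injective.injOn, integrableOn_univ]
  simp [Real.abs_exp]

lemma exp_half_mul_exp_half (t : ℝ) : Real.exp (t / 2) * Real.exp (t / 2) = Real.exp t := by
  rw [← Real.exp_add, add_halves]

namespace H10

lemma memLp_timeChange (g : H10) :
    MemLp (fun t => Real.exp (t / 2) * deriv g (Real.exp t)) 2 volume := by
  have hm : Measurable fun t => Real.exp (t / 2) * deriv g (Real.exp t) := by
    have := measurable_deriv g
    fun_prop
  refine (memLp_two_iff_integrable_sq hm.aestronglyMeasurable).2 ?_
  refine ((integrableOn_Ioi_iff_integrable_exp _).1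
    (g.acl2.2.integrable_sq.integrableOn (s := Set.Ioi 0))).congr (.of_forall fun t => ?_)
  simp only [← exp_half_mul_exp_half t]
  ring

/-- The isometry `g ↦ (t ↦ e^{t / 2} ġ(e^t))` of `H¹₀` into `L²(ℝ)`. -/
def timeChange : H10 →ₗᵢ[ℝ] Lp ℝ 2 (volume : Measure ℝ) where
  toFun g := g.memLp_timeChange.toLp _
  map_add' f g := by
    rw [← MemLp.toLp_add]
    refine MemLp.toLp_congr _ _ ?_
    filter_upwards [ae_comp_exp (ACL2.deriv_add_ae f.acl2 g.acl2)] with t ht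
    rw [coe_add, ht]
    simp only [Pi.add_apply]
    ring
  map_smul' c f := by
    rw [RingHom.id_apply, ← MemLp.toLp_const_smul]
    refine MemLp.toLp_congr _ _ (.of_forall fun t => ?_)
    rw [coe_smul, ACL2.deriv_smul_eq]
    simp only [Pi.smul_apply, smul_eq_mul]
    ring
  norm_map' g := by
    have h1 : ‖(g.memLp_timeChange.toLp _ : Lp ℝ 2 (volume : Measure ℝ))‖ ^ 2 = ‖g‖ ^ 2 := by
      rw [← real_inner_self_eq_norm_sq, ← real_inner_self_eq_norm_sq, L2.inner_def, inner_def,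
        integral_Ioi_eq_integral_exp]
      refine integral_congr_ae ?_
      filter_upwards [g.memLp_timeChange.coeFn_toLp] with t ht
      rw [ht]
      simp only [RCLike.inner_apply, conj_trivial, ← exp_half_mul_exp_half t]
      ring
    exact (sq_eq_sq₀ (norm_nonneg _) (norm_nonneg _)).1 h1

lemma coeFn_timeChange (g : H10) :
    timeChange g =ᵐ[volume] fun t => Real.exp (t / 2) * deriv g (Real.exp t) :=
  g.memLp_timeChange.coeFn_toLp

/-- The density `s ↦ s^{-1/2} φ(log s)` on `(0, ∞)`, the inverse image of `φ` under the
time change. -/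
def density (φ : Lp ℝ 2 (volume : Measure ℝ)) (s : ℝ) : ℝ :=
  (Set.Ioi 0).indicator (fun s => Real.exp (-Real.log s / 2) * φ (Real.log s)) s

lemma density_exp (φ : Lp ℝ 2 (volume : Measure ℝ)) (t : ℝ) :
    density φ (Real.exp t) = Real.exp (-t / 2) * φ t := by
  simp [density, Set.indicator_of_mem, Real.exp_pos]

lemma memLp_density (φ : Lp ℝ 2 (volume : Measure ℝ)) : MemLp (density φ) 2 volume := by
  have hm : Measurable (density φ) := by
    refine Measurable.indicator ?_ measurableSet_Ioi
    have h1 := (Lp.stronglyMeasurable φ).measurable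
    have h2 := Real.measurable_log
    fun_prop
  refine (memLp_two_iff_integrable_sq hm.aestronglyMeasurable).2 ?_
  have h1 : IntegrableOn (fun s => density φ s ^ 2) (Set.Ioi 0) := by
    refine (integrableOn_Ioi_iff_integrable_exp _).2 ?_
    refine (Lp.memLp φ).integrable_sq.congr (.of_forall fun t => ?_)
    simp only [density_exp, mul_pow, ← Real.exp_nat_mul, ← mul_assoc, ← Real.exp_add]
    ring_nf
    simp
  refine (integrableOn_iff_integrable_of_support_subset fun s hs => ?_).1 h1
  by_contra h
  exact hs (by simp [density, Set.indicator_of_notMem h])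

/-- The primitive of `density φ`, an element of `H¹₀`. -/
def ofDensity (φ : Lp ℝ 2 (volume : Measure ℝ)) : H10 :=
  have hl := (memLp_density φ).locallyIntegrable (by norm_num)
  ⟨fun t => ∫ s in (0 : ℝ)..t, density φ s, fun t ht => by
    refine intervalIntegral.integral_zero_ae (.of_forall fun s hs => ?_)
    rw [Set.uIoc_of_ge ht] at hs
    exact Set.indicator_of_notMem (by simpa using hs.2) _, by
    refine ⟨absolutelyContinuousOnInterval_primitive hl, (memLp_congr_ae ?_).2 (memLp_density φ)⟩
    filter_upwards [ae_hasDerivAt_primitive hl] with s hs using hs.deriv⟩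

lemma timeChange_ofDensity (φ : Lp ℝ 2 (volume : Measure ℝ)) : timeChange (ofDensity φ) = φ := by
  refine Lp.ext ?_
  filter_upwards [coeFn_timeChange (ofDensity φ), ae_comp_exp (ae_hasDerivAt_primitive
    ((memLp_density φ).locallyIntegrable (by norm_num)))] with t h1 h2
  have h3 : deriv (ofDensity φ) (Real.exp t) = density φ (Real.exp t) := h2.deriv
  rw [h1, h3, density_exp, ← mul_assoc, ← Real.exp_add]
  ring_nf
  simp

/-- The isometric isomorphism `(F g)(t) = e^{-t/2} g(e^t)` of `H¹₀` onto `H^U`, built from the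
identity `(F g)' + F g / 2 = e^{t / 2} ġ(e^t)`. -/
def transport : H10 ≃ₗᵢ[ℝ] HU :=
  (LinearIsometryEquiv.ofSurjective timeChange
    fun φ => ⟨ofDensity φ, timeChange_ofDensity φ⟩).trans HU.drift.symm

lemma drift_transport (g : H10) : HU.drift (transport g) = timeChange g :=
  HU.drift.apply_symm_apply _

lemma transport_apply (g : H10) (t : ℝ) :
    transport g t = Real.exp (-t / 2) * g (Real.exp t) := by
  have h1 : transport g = HU.drift.symm (timeChange g) := rfl
  have h2 : HU.drift.symm (timeChange g) t = HU.driftSol (timeChange g) t := by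
    rw [HU.drift_symm]
    rfl
  rw [h1, h2, HU.driftSol_eq]
  congr 1
  have h3 : ∫ r in Set.Iic t, Real.exp (r / 2) * timeChange g r =
      ∫ r in Set.Iic t, Real.exp r * deriv g (Real.exp r) := by
    refine integral_congr_ae (ae_restrict_of_ae ?_)
    filter_upwards [coeFn_timeChange g] with r hr
    rw [hr, ← mul_assoc, exp_half_mul_exp_half]
  have h4 : Real.exp '' Set.Iic t = Set.Ioc 0 (Real.exp t) := by
    ext s
    refine ⟨?_, fun hs => ⟨Real.log s, ?_, Real.exp_log hs.1⟩⟩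
    · rintro ⟨r, hr, rfl⟩
      exact ⟨Real.exp_pos r, Real.exp_le_exp.2 hr⟩
    · exact (Real.log_le_iff_le_exp hs.1).2 hs.2
  rw [h3, ← setIntegral_exp_image _ measurableSet_Iic, h4,
    ← intervalIntegral.integral_of_le (Real.exp_pos t).le, (g.acl2.1 _ _).integral_deriv_eq_sub,
    g.eq_zero_of_nonpos le_rfl, sub_zero]

lemma isOUTransport_transport : IsOUTransport transport := transport_apply

/-- In logarithmic time, `g ↦ ∫₀ᵗ g(s) / s ds` is the inverse of `h ↦ h' + h / 2`. -/
lemma transport_symm_drift_symm_apply (g : H10) {t : ℝ} (ht : 0 ≤ t) :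
    transport.symm (HU.drift.symm (transport g).toL2) t = ∫ s in (0 : ℝ)..t, g s / s := by
  set G := transport.symm (HU.drift.symm (transport g).toL2) with hG
  have h1 : timeChange G = (transport g).toL2 := by
    rw [← drift_transport, hG, LinearIsometryEquiv.apply_symm_apply,
      LinearIsometryEquiv.apply_symm_apply]
  have h2 : ∀ᵐ r, deriv G (Real.exp r) = g (Real.exp r) / Real.exp r := by
    filter_upwards [coeFn_timeChange G, (transport g).memLp.coeFn_toLp] with r h3 h4
    rw [h1, HU.toL2, h4, transport_apply] at h3
    have h5 : Real.exp (-r / 2) = Real.exp (r / 2) / Real.exp r := by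
      rw [← Real.exp_sub]
      ring_nf
    rw [h5, div_mul_eq_mul_div, mul_div_assoc] at h3
    exact (mul_left_cancel₀ (Real.exp_ne_zero _) h3).symm
  have h3 := (G.acl2.1 0 t).integral_deriv_eq_sub
  rw [G.eq_zero_of_nonpos le_rfl, sub_zero] at h3
  rw [← h3]
  refine intervalIntegral.integral_congr_ae ?_
  filter_upwards [ae_of_ae_comp_exp (p := fun s => deriv G s = g s / s) h2] with s hs hst
  rw [Set.uIoc_of_le ht] at hst
  exact hs hst.1

end H10

/-! ### The Fourier transform of real square-integrable functions -/

open ComplexConjugate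
open scoped SchwartzMap LineDeriv

/-- Complexification of real square-integrable functions. -/
def cplx (φ : Lp ℝ 2 (volume : Measure ℝ)) : Lp ℂ 2 (volume : Measure ℝ) :=
  Complex.ofRealCLM.compLp φ

lemma coeFn_cplx (φ : Lp ℝ 2 (volume : Measure ℝ)) : cplx φ =ᵐ[volume] fun x => (φ x : ℂ) :=
  Complex.ofRealCLM.coeFn_compLp φ

lemma norm_cplx (φ : Lp ℝ 2 (volume : Measure ℝ)) : ‖cplx φ‖ = ‖φ‖ := by
  rw [Lp.norm_def, Lp.norm_def]
  congr 1
  refine eLpNorm_congr_norm_ae ?_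
  filter_upwards [coeFn_cplx φ] with x hx
  simp [hx]

/-- The Fourier transform of a real function, as an isometry `L²(ℝ; ℝ) → L²(ℝ; ℂ)`. -/
def fourierReal : Lp ℝ 2 (volume : Measure ℝ) →ₗᵢ[ℝ] Lp ℂ 2 (volume : Measure ℝ) where
  toFun φ := 𝓕 (cplx φ)
  map_add' φ ψ := by
    have h : cplx (φ + ψ) = cplx φ + cplx ψ := (Complex.ofRealCLM.compLpₗ 2 volume).map_add φ ψ
    rw [h, FourierTransform.fourier_add]
  map_smul' c φ := by
    have h : cplx (c • φ) = (c : ℂ) • cplx φ := (Complex.ofRealCLM.compLpₗ 2 volume).map_smul c φ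
    rw [h, FourierTransform.fourier_smul]
    rfl
  norm_map' φ := (Lp.norm_fourier_eq _).trans (norm_cplx φ)

lemma fourierReal_apply (φ : Lp ℝ 2 (volume : Measure ℝ)) : fourierReal φ = 𝓕 (cplx φ) := rfl

lemma fourierReal_ext {φ ψ : Lp ℝ 2 (volume : Measure ℝ)}
    (h : fourierReal φ =ᵐ[volume] fourierReal ψ) : φ = ψ :=
  fourierReal.injective (Lp.ext h)

/-- Complex conjugation on `L²(ℝ; ℂ)`. -/
def conjLp : Lp ℂ 2 (volume : Measure ℝ) →L[ℝ] Lp ℂ 2 (volume : Measure ℝ) :=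
  (Complex.conjCLE : ℂ →L[ℝ] ℂ).compLpL 2 volume

lemma coeFn_conjLp (f : Lp ℂ 2 (volume : Measure ℝ)) :
    conjLp f =ᵐ[volume] fun x => conj (f x) :=
  (Complex.conjCLE : ℂ →L[ℝ] ℂ).coeFn_compLp f

/-- The reflection `f ↦ f(-·)` on `L²(ℝ; ℂ)`. -/
def reflLp : Lp ℂ 2 (volume : Measure ℝ) →ₗᵢ[ℝ] Lp ℂ 2 (volume : Measure ℝ) :=
  Lp.compMeasurePreservingₗᵢ ℝ Neg.neg (Measure.measurePreserving_neg volume)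

lemma coeFn_reflLp (f : Lp ℂ 2 (volume : Measure ℝ)) : reflLp f =ᵐ[volume] fun x => f (-x) :=
  Lp.coeFn_compMeasurePreserving f (Measure.measurePreserving_neg volume)

lemma ae_neg {p : ℝ → Prop} (h : ∀ᵐ x, p x) : ∀ᵐ x, p (-x) :=
  (Measure.measurePreserving_neg (volume : Measure ℝ)).quasiMeasurePreserving.ae h

/-- The Fourier transform of `f̄` is `ξ ↦ conj (f̂(-ξ))`, by density of Schwartz functions. -/
lemma fourier_conjLp (f : Lp ℂ 2 (volume : Measure ℝ)) :
    𝓕 (conjLp f) = reflLp (conjLp (𝓕 f)) := by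
  refine DenseRange.induction_on (p := fun f => 𝓕 (conjLp f) = reflLp (conjLp (𝓕 f)))
    (SchwartzMap.denseRange_toLpCLM (p := 2) (F := ℂ) (E := ℝ) (μ := volume)
      ENNReal.ofNat_ne_top) f ?_ ?_
  · have hF : Continuous fun f : Lp ℂ 2 (volume : Measure ℝ) => 𝓕 f :=
      (Lp.fourierTransformₗᵢ ℝ ℂ).continuous
    exact isClosed_eq (hF.comp conjLp.continuous)
      (reflLp.continuous.comp (conjLp.continuous.comp hF))
  · intro g
    set g' : 𝓢(ℝ, ℂ) := SchwartzMap.postcompCLM (𝕜 := ℝ) (Complex.conjCLE : ℂ →L[ℝ] ℂ) g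
    have h1 : conjLp (g.toLp 2 volume) = g'.toLp 2 volume := by
      refine Lp.ext ?_
      filter_upwards [coeFn_conjLp (g.toLp 2 volume), g.coeFn_toLp 2 volume,
        g'.coeFn_toLp 2 volume] with x h1 h2 h3
      rw [h1, h2, h3]
      rfl
    rw [SchwartzMap.toLpCLM_apply, h1, SchwartzMap.toLp_fourier_eq, SchwartzMap.toLp_fourier_eq]
    refine Lp.ext ?_
    filter_upwards [coeFn_reflLp (conjLp ((𝓕 g).toLp 2 volume)), (𝓕 g').coeFn_toLp 2 volume,
      ae_neg (coeFn_conjLp ((𝓕 g).toLp 2 volume)), ae_neg ((𝓕 g).coeFn_toLp 2 volume)]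
      with x h1 h2 h3 h4
    rw [h1, h2, h3, h4, SchwartzMap.fourier_coe, SchwartzMap.fourier_coe, Real.fourier_eq',
      Real.fourier_eq', ← integral_conj]
    refine integral_congr_ae (.of_forall fun v => ?_)
    have hv : g' v = conj (g v) := rfl
    simp only [hv, smul_eq_mul, map_mul, ← Complex.exp_conj, Complex.conj_ofReal, Complex.conj_I]
    congr 2
    simp

lemma conjLp_cplx (φ : Lp ℝ 2 (volume : Measure ℝ)) : conjLp (cplx φ) = cplx φ := by
  refine Lp.ext ?_
  filter_upwards [coeFn_conjLp (cplx φ), coeFn_cplx φ] with x h1 h2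
  rw [h1, h2, Complex.conj_ofReal]

lemma conj_fourierReal_neg (φ : Lp ℝ 2 (volume : Measure ℝ)) :
    ∀ᵐ ξ, conj (fourierReal φ (-ξ)) = fourierReal φ ξ := by
  have h := fourier_conjLp (cplx φ)
  rw [conjLp_cplx, ← fourierReal_apply] at h
  filter_upwards [coeFn_reflLp (conjLp (fourierReal φ)), ae_neg (coeFn_conjLp (fourierReal φ))]
    with ξ h1 h2
  rw [← h2, ← h1, ← h]

/-- A square-integrable function with Hermitian symmetry is the Fourier transform of a real
function. -/
lemma exists_fourierReal_eq {ψ : Lp ℂ 2 (volume : Measure ℝ)}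
    (hψ : ∀ᵐ ξ, conj (ψ (-ξ)) = ψ ξ) : ∃ φ, fourierReal φ = ψ := by
  obtain ⟨f, rfl⟩ := (Lp.fourierTransformₗᵢ ℝ ℂ).surjective ψ
  change ∀ᵐ ξ, conj ((𝓕 f : Lp ℂ 2 (volume : Measure ℝ)) (-ξ)) =
    (𝓕 f : Lp ℂ 2 (volume : Measure ℝ)) ξ at hψ
  change ∃ φ, fourierReal φ = 𝓕 f
  have h1 : conjLp f = f := by
    refine (Lp.fourierTransformₗᵢ ℝ ℂ).injective ?_
    change 𝓕 (conjLp f) = 𝓕 f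
    rw [fourier_conjLp]
    refine Lp.ext ?_
    filter_upwards [hψ, coeFn_reflLp (conjLp (𝓕 f)), ae_neg (coeFn_conjLp (𝓕 f))] with ξ h1 h2 h3
    rw [h2, h3, h1]
  refine ⟨Complex.reCLM.compLp f, ?_⟩
  rw [fourierReal_apply]
  congr 1
  refine Lp.ext ?_
  filter_upwards [coeFn_cplx (Complex.reCLM.compLp f), Complex.reCLM.coeFn_compLp f,
    coeFn_conjLp f] with x h2 h3 h4
  rw [h1] at h4
  rw [h2, h3]
  exact Complex.conj_eq_iff_re.1 h4.symm

/-! ### The Fourier transform of the derivative -/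

lemma HU.fourier_eq (h : HU) : h.fourier = fourierReal h.toL2 := by
  rw [HU.fourier, fourierReal_apply]
  congr 1

lemma HU.integral_deriv_mul_add_mul_deriv (h : HU) {p : ℝ → ℝ} (hp : ContDiff ℝ 1 p)
    (hp2 : MemLp p 2 volume) (hd2 : MemLp (deriv p) 2 volume) :
    ∫ x, (deriv p x * h x + p x * deriv h x) = 0 := by
  have hd : deriv (fun x => p x * h x) =ᵐ[volume] fun x => deriv p x * h x + p x * deriv h x := by
    filter_upwards [h.ae_differentiableAt] with x hx
    exact deriv_fun_mul (hp.differentiable (by norm_num) x) hx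
  have h1 : Integrable (fun x => deriv p x * h x) := hd2.integrable_mul h.memLp
  have h2 : Integrable (fun x => p x * deriv h x) := hp2.integrable_mul h.acl2.2
  rw [← integral_congr_ae hd]
  exact integral_deriv_eq_zero_of_integrable
    (fun a b => (hp.contDiffOn.absolutelyContinuousOnInterval).fun_mul (h.acl2.1 a b))
    (hp2.integrable_mul h.memLp) ((integrable_congr hd).2 (h1.add h2))

lemma HU.integral_schwartz_mul_deriv (h : HU) (g : 𝓢(ℝ, ℂ)) :
    ∫ x, g x * ((deriv h x : ℝ) : ℂ) = -∫ x, deriv g x * (h x : ℂ) := by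
  have hg' : MemLp (deriv g) 2 volume := (SchwartzMap.derivCLM ℂ ℂ g).memLp 2 volume
  have h1 : Integrable (fun x => deriv g x * (h x : ℂ)) :=
    hg'.integrable_mul h.memLp.ofReal
  have h2 : Integrable (fun x => g x * ((deriv h x : ℝ) : ℂ)) :=
    (g.memLp 2 volume).integrable_mul h.acl2.2.ofReal
  -- `L` will be the real and the imaginary part
  have key : ∀ L : ℂ →L[ℝ] ℝ, (∀ (z : ℂ) (r : ℝ), L (z * r) = L z * r) →
      L (∫ x, (deriv g x * (h x : ℂ) + g x * ((deriv h x : ℝ) : ℂ))) = 0 := by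
    intro L hL
    have h3 : Integrable (fun x => deriv g x * (h x : ℂ) + g x * ((deriv h x : ℝ) : ℂ)) := h1.add h2
    rw [← L.integral_comp_comm h3]
    have hd : ∀ x, deriv (fun x => L (g x)) x = L (deriv g x) := fun x =>
      (L.hasFDerivAt.comp_hasDerivAt x (g.hasDerivAt x)).deriv
    have := h.integral_deriv_mul_add_mul_deriv (p := fun x => L (g x))
      (L.contDiff.comp (g.smooth 1)) (L.comp_memLp' (g.memLp 2 volume))
      (by rw [funext hd]; exact L.comp_memLp' hg')
    simpa [hL, hd] using this
  have h3 : ∫ x, (deriv g x * (h x : ℂ) + g x * ((deriv h x : ℝ) : ℂ)) = 0 :=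
    Complex.ext (key Complex.reCLM fun z r => by simp) (key Complex.imCLM fun z r => by simp)
  rw [integral_add h1 h2] at h3
  linear_combination h3

/-- The derivative of `h`, in `L²(ℝ)`. -/
def HU.derivL2 (h : HU) : Lp ℝ 2 (volume : Measure ℝ) := h.acl2.2.toLp _

/-- The almost everywhere derivative of `h` is its derivative as a tempered distribution. -/
lemma HU.lineDeriv_toTemperedDistribution (h : HU) :
    ((cplx h.derivL2 : Lp ℂ 2 (volume : Measure ℝ)) : 𝓢'(ℝ, ℂ)) =
      ∂_{(1 : ℝ)} ((cplx h.toL2 : Lp ℂ 2 (volume : Measure ℝ)) : 𝓢'(ℝ, ℂ)) := by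
  ext g
  rw [TemperedDistribution.lineDerivOp_apply_apply, Lp.toTemperedDistribution_apply,
    Lp.toTemperedDistribution_apply]
  have h1 : ∫ x, g x • (cplx h.derivL2) x = ∫ x, g x * ((deriv h x : ℝ) : ℂ) := by
    refine integral_congr_ae ?_
    filter_upwards [coeFn_cplx h.derivL2, h.acl2.2.coeFn_toLp] with x h1 h2
    rw [h1, HU.derivL2, h2, smul_eq_mul]
  have h2 : ∫ x, (-∂_{(1 : ℝ)} g) x • (cplx h.toL2) x = ∫ x, -(deriv g x * (h x : ℂ)) := by
    refine integral_congr_ae ?_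
    filter_upwards [coeFn_cplx h.toL2, h.memLp.coeFn_toLp] with x h1 h2
    rw [h1, HU.toL2, h2, smul_eq_mul, neg_apply, SchwartzMap.lineDerivOp_apply_eq_fderiv,
      fderiv_apply_one_eq_deriv, neg_mul]
  rw [h1, h2, h.integral_schwartz_mul_deriv, integral_neg]

lemma HU.fourierReal_derivL2 (h : HU) :
    ∀ᵐ ξ : ℝ, fourierReal h.derivL2 ξ = 2 * Real.pi * Complex.I * ξ * h.fourier ξ := by
  have h0 : LocallyIntegrable fun ξ : ℝ => 2 * Real.pi * Complex.I * ξ * h.fourier ξ := by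
    have h1 := (Lp.memLp h.fourier).locallyIntegrable (by norm_num)
    exact locallyIntegrableOn_univ.1 ((locallyIntegrableOn_univ.2 h1).continuousOn_mul
      (g := fun ξ : ℝ => 2 * Real.pi * Complex.I * ξ) (by fun_prop) isOpen_univ.isLocallyClosed)
  refine ae_eq_of_integral_contDiff_smul_eq
    ((Lp.memLp (fourierReal h.derivL2)).locallyIntegrable (by norm_num)) h0 fun g hg hgc => ?_
  -- the real test function `g`, regarded as a complex Schwartz function
  have hg₁ : HasCompactSupport (Complex.ofRealCLM ∘ g) := hgc.comp_left rfl
  have hg₂ : ContDiff ℝ _ (Complex.ofRealCLM ∘ g) := Complex.ofRealCLM.contDiff.comp hg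
  have hT := congrArg (fun T : 𝓢'(ℝ, ℂ) => T (hg₁.toSchwartzMap hg₂))
    (congrArg (fun T : 𝓢'(ℝ, ℂ) => 𝓕 T) h.lineDeriv_toTemperedDistribution)
  have hgrow : (fun x : ℝ => ((inner ℝ x (1 : ℝ) : ℝ) : ℂ)).HasTemperateGrowth := by fun_prop
  simp only [TemperedDistribution.fourier_lineDerivOp_eq, Lp.fourier_toTemperedDistribution_eq]
    at hT
  rw [← fourierReal_apply, ← fourierReal_apply, ← HU.fourier_eq] at hT
  rw [Lp.toTemperedDistribution_apply] at hT
  have h1 : ∫ x, g x • fourierReal h.derivL2 x =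
      ∫ x, (hg₁.toSchwartzMap hg₂) x • fourierReal h.derivL2 x := by
    refine integral_congr_ae (.of_forall fun x => ?_)
    simp
  rw [h1, hT]
  simp only [smul_apply, TemperedDistribution.smulLeftCLM_apply_apply,
    Lp.toTemperedDistribution_apply]
  rw [← integral_smul]
  refine integral_congr_ae (.of_forall fun x => ?_)
  simp only [SchwartzMap.smulLeftCLM_apply_apply hgrow]
  simp
  ring

/-- On the Fourier side, `h ↦ h' + h / 2` is multiplication by `1/2 + iλ`, where `λ = 2πξ`. -/
lemma HU.fourierReal_drift (h : HU) :
    ∀ᵐ ξ : ℝ, fourierReal (HU.drift h) ξ = (1 / 2 + 2 * Real.pi * Complex.I * ξ) * h.fourier ξ := by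
  have h1 : HU.drift h = h.derivL2 + (1 / 2 : ℝ) • h.toL2 := by
    refine Lp.ext ?_
    filter_upwards [HU.coeFn_drift h, Lp.coeFn_add h.derivL2 ((1 / 2 : ℝ) • h.toL2),
      Lp.coeFn_smul (1 / 2 : ℝ) h.toL2, h.acl2.2.coeFn_toLp, h.memLp.coeFn_toLp]
      with x h1 h2 h3 h4 h5
    rw [h1, h2, Pi.add_apply, h3, Pi.smul_apply, HU.derivL2, HU.toL2, h4, h5, smul_eq_mul]
  rw [h1, map_add, map_smul, ← HU.fourier_eq]
  filter_upwards [Lp.coeFn_add (fourierReal h.derivL2) ((1 / 2 : ℝ) • h.fourier),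
    Lp.coeFn_smul (1 / 2 : ℝ) h.fourier, h.fourierReal_derivL2] with ξ h2 h3 h4
  rw [h2, Pi.add_apply, h3, h4, Pi.smul_apply, Complex.real_smul]
  push_cast
  ring

lemma half_add_mul_I_ne_zero (ξ : ℝ) : (1 / 2 + 2 * Real.pi * Complex.I * ξ : ℂ) ≠ 0 := by
  intro h
  have := congrArg Complex.re h
  simp at this

lemma HU.fourier_ext {g h : HU} (hgh : g.fourier =ᵐ[volume] h.fourier) : g = h := by
  refine HU.drift.injective (fourierReal_ext ?_)
  filter_upwards [g.fourierReal_drift, h.fourierReal_drift, hgh] with ξ h1 h2 h3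
  rw [h1, h2, h3]

/-! ### The unitary group on `L²(ℝ)` -/

lemma symbol_eq (u l : ℝ) :
    symbol u l = Complex.exp ((-2 * u * Real.arctan (2 * l) : ℝ) * Complex.I) := by
  rw [symbol]
  congr 1
  push_cast
  ring

lemma norm_symbol (u l : ℝ) : ‖symbol u l‖ = 1 := by
  rw [symbol_eq, Complex.norm_exp_ofReal_mul_I]

lemma symbol_add (u v l : ℝ) : symbol (u + v) l = symbol u l * symbol v l := by
  rw [symbol, symbol, symbol, ← Complex.exp_add]
  congr 1
  push_cast
  ring

lemma symbol_zero (l : ℝ) : symbol 0 l = 1 := by simp [symbol]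

lemma conj_symbol_neg (u l : ℝ) : conj (symbol u (-l)) = symbol u l := by
  rw [symbol_eq, symbol_eq, ← Complex.exp_conj]
  congr 1
  rw [map_mul, Complex.conj_ofReal, Complex.conj_I, mul_neg 2 l, Real.arctan_neg]
  push_cast
  ring

lemma continuous_symbol : Continuous fun p : ℝ × ℝ => symbol p.1 p.2 := by
  simp only [symbol]
  fun_prop

/-- At time `1` the symbol is the Cayley transform `(1/2 - iλ) / (1/2 + iλ)`. -/
lemma mul_symbol_one (l : ℝ) :
    (1 / 2 + Complex.I * l) * symbol 1 l = 1 / 2 - Complex.I * l := by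
  set θ := Real.arctan (2 * l) with hθ
  have hc : (Real.cos θ : ℂ) ≠ 0 := by exact_mod_cast (Real.cos_arctan_pos (2 * l)).ne'
  have hl : (2 * l : ℂ) * Real.cos θ = Real.sin θ := by
    have h := Real.tan_mul_cos (Real.cos_arctan_pos (2 * l)).ne'
    rw [Real.tan_arctan] at h
    exact_mod_cast h
  have hs : symbol 1 l = (Real.cos θ - Real.sin θ * Complex.I) ^ 2 := by
    rw [symbol, ← hθ, ← Complex.exp_ofReal_mul_I_re, ← Complex.exp_ofReal_mul_I_im]
    have h1 : (((Complex.exp (θ * Complex.I)).re : ℂ) -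
        ((Complex.exp (θ * Complex.I)).im : ℂ) * Complex.I) = Complex.exp (-(θ * Complex.I)) := by
      have h (z : ℂ) : (z.re : ℂ) - (z.im : ℂ) * Complex.I = conj z := by
        apply Complex.ext <;> simp
      rw [h, ← Complex.exp_conj]
      simp
    rw [h1, ← Complex.exp_nat_mul]
    congr 1
    push_cast
    ring
  have h2 : (Real.cos θ : ℂ) ^ 2 + (Real.sin θ : ℂ) ^ 2 = 1 := by
    exact_mod_cast Real.cos_sq_add_sin_sq θ
  rw [hs]
  refine mul_left_cancel₀ hc ?_
  linear_combination
    (Complex.I / 2 * (Real.cos θ - Real.sin θ * Complex.I) ^ 2 + Complex.I / 2) * hl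
    + 1 / 2 * (Real.cos θ - Real.sin θ * Complex.I) * h2
    - 1 / 2 * (Real.cos θ - Real.sin θ * Complex.I) * (Real.sin θ) ^ 2 * Complex.I_sq

lemma exists_fourierReal_eq_symbol_mul (u : ℝ) (φ : Lp ℝ 2 (volume : Measure ℝ)) :
    ∃ ψ, ∀ᵐ ξ : ℝ, fourierReal ψ ξ = symbol u (2 * Real.pi * ξ) * fourierReal φ ξ := by
  have hm : MemLp (fun ξ => symbol u (2 * Real.pi * ξ) * fourierReal φ ξ) 2 volume := by
    refine (Lp.memLp (fourierReal φ)).of_le ?_ (.of_forall fun ξ => ?_)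
    · refine AEStronglyMeasurable.mul ?_ (Lp.aestronglyMeasurable _)
      exact (continuous_symbol.comp (by fun_prop : Continuous fun ξ : ℝ =>
        (u, 2 * Real.pi * ξ))).aestronglyMeasurable
    · rw [norm_mul, norm_symbol, one_mul]
  obtain ⟨ψ, hψ⟩ := exists_fourierReal_eq (ψ := hm.toLp _) (by
    filter_upwards [hm.coeFn_toLp, ae_neg hm.coeFn_toLp, conj_fourierReal_neg φ] with ξ h1 h2 h3
    rw [h1, h2, map_mul, h3, mul_neg, conj_symbol_neg])
  refine ⟨ψ, ?_⟩
  rw [hψ]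
  exact hm.coeFn_toLp

/-- The Fourier multiplier with symbol `e^{-2iu arctan(2λ)}` on `L²(ℝ; ℝ)`. -/
def rotateFun (u : ℝ) (φ : Lp ℝ 2 (volume : Measure ℝ)) : Lp ℝ 2 (volume : Measure ℝ) :=
  (exists_fourierReal_eq_symbol_mul u φ).choose

lemma fourierReal_rotateFun (u : ℝ) (φ : Lp ℝ 2 (volume : Measure ℝ)) :
    ∀ᵐ ξ : ℝ, fourierReal (rotateFun u φ) ξ = symbol u (2 * Real.pi * ξ) * fourierReal φ ξ :=
  (exists_fourierReal_eq_symbol_mul u φ).choose_spec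

lemma rotateFun_zero (φ : Lp ℝ 2 (volume : Measure ℝ)) : rotateFun 0 φ = φ := by
  refine fourierReal_ext ?_
  filter_upwards [fourierReal_rotateFun 0 φ] with ξ h
  rw [h, symbol_zero, one_mul]

lemma rotateFun_add (u v : ℝ) (φ : Lp ℝ 2 (volume : Measure ℝ)) :
    rotateFun (u + v) φ = rotateFun u (rotateFun v φ) := by
  refine fourierReal_ext ?_
  filter_upwards [fourierReal_rotateFun (u + v) φ, fourierReal_rotateFun u (rotateFun v φ),
    fourierReal_rotateFun v φ] with ξ h1 h2 h3
  rw [h1, h2, h3, symbol_add, mul_assoc]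

/-- `rotateFun u` as an orthogonal transformation. -/
def rotate (u : ℝ) : Lp ℝ 2 (volume : Measure ℝ) ≃ₗᵢ[ℝ] Lp ℝ 2 (volume : Measure ℝ) where
  toFun := rotateFun u
  invFun := rotateFun (-u)
  left_inv φ := by rw [← rotateFun_add, neg_add_cancel, rotateFun_zero]
  right_inv φ := by rw [← rotateFun_add, add_neg_cancel, rotateFun_zero]
  map_add' φ ψ := by
    refine fourierReal_ext ?_
    rw [map_add]
    filter_upwards [fourierReal_rotateFun u (φ + ψ), fourierReal_rotateFun u φ,
      fourierReal_rotateFun u ψ, Lp.coeFn_add (fourierReal φ) (fourierReal ψ),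
      Lp.coeFn_add (fourierReal (rotateFun u φ)) (fourierReal (rotateFun u ψ))]
      with ξ h1 h2 h3 h4 h5
    rw [h1, h5, map_add, h4, Pi.add_apply, Pi.add_apply, h2, h3, mul_add]
  map_smul' c φ := by
    refine fourierReal_ext ?_
    rw [RingHom.id_apply, map_smul]
    filter_upwards [fourierReal_rotateFun u (c • φ), fourierReal_rotateFun u φ,
      Lp.coeFn_smul c (fourierReal φ), Lp.coeFn_smul c (fourierReal (rotateFun u φ))]
      with ξ h1 h2 h3 h4
    rw [h1, h4, map_smul, h3, Pi.smul_apply, Pi.smul_apply, h2, mul_smul_comm]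
  norm_map' φ := by
    change ‖rotateFun u φ‖ = ‖φ‖
    rw [← fourierReal.norm_map (rotateFun u φ), ← fourierReal.norm_map φ, Lp.norm_def, Lp.norm_def]
    congr 1
    refine eLpNorm_congr_norm_ae ?_
    filter_upwards [fourierReal_rotateFun u φ] with ξ h
    rw [h, norm_mul, norm_symbol, one_mul]

lemma fourierReal_rotate (u : ℝ) (φ : Lp ℝ 2 (volume : Measure ℝ)) :
    ∀ᵐ ξ : ℝ, fourierReal (rotate u φ) ξ = symbol u (2 * Real.pi * ξ) * fourierReal φ ξ :=
  fourierReal_rotateFun u φ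

/-- The spectral density of the matrix coefficients of the group. -/
def crossDensity (φ ψ : Lp ℝ 2 (volume : Measure ℝ)) (ξ : ℝ) : ℂ :=
  conj (fourierReal φ ξ) * fourierReal ψ ξ

lemma integrable_crossDensity (φ ψ : Lp ℝ 2 (volume : Measure ℝ)) :
    Integrable (crossDensity φ ψ) :=
  (Lp.memLp (fourierReal φ)).star.integrable_mul (Lp.memLp (fourierReal ψ))

lemma integrable_symbol_mul {ρ : ℝ → ℂ} (hρ : Integrable ρ) (u : ℝ) :
    Integrable fun ξ : ℝ => symbol u (2 * Real.pi * ξ) * ρ ξ := by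
  refine hρ.mono ?_ (.of_forall fun ξ => by rw [norm_mul, norm_symbol, one_mul])
  refine AEStronglyMeasurable.mul ?_ hρ.aestronglyMeasurable
  exact (continuous_symbol.comp (by fun_prop : Continuous fun ξ : ℝ =>
    (u, 2 * Real.pi * ξ))).aestronglyMeasurable

lemma inner_rotate (u : ℝ) (φ ψ : Lp ℝ 2 (volume : Measure ℝ)) :
    ⟪φ, rotate u ψ⟫ = (∫ ξ : ℝ, symbol u (2 * Real.pi * ξ) * crossDensity φ ψ ξ).re := by
  have h2 := Complex.reCLM.integral_comp_comm
    (integrable_symbol_mul (integrable_crossDensity φ ψ) u)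
  simp only [Complex.reCLM_apply] at h2
  rw [← fourierReal.inner_map_map, L2.inner_def, ← h2]
  refine integral_congr_ae ?_
  filter_upwards [fourierReal_rotate u ψ] with ξ h1
  rw [h1, crossDensity, Complex.inner]
  ring_nf

lemma continuous_integral_symbol_mul {ρ : ℝ → ℂ} (hρ : Integrable ρ) :
    Continuous fun u : ℝ => ∫ ξ : ℝ, symbol u (2 * Real.pi * ξ) * ρ ξ := by
  refine continuous_of_dominated (fun u => (integrable_symbol_mul hρ u).aestronglyMeasurable)
    (bound := fun ξ => ‖ρ ξ‖) (fun u => .of_forall fun ξ => ?_) hρ.norm (.of_forall fun ξ => ?_)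
  · rw [norm_mul, norm_symbol, one_mul]
  · exact (continuous_symbol.comp (by fun_prop : Continuous fun u : ℝ =>
      (u, 2 * Real.pi * ξ))).mul continuous_const

/-- The substitution `λ = tan θ / 2` turns the integral into a Fourier transform in `u`, so that
the Riemann–Lebesgue lemma applies. -/
lemma tendsto_integral_symbol_mul (ρ : ℝ → ℂ) :
    Tendsto (fun u : ℝ => ∫ ξ : ℝ, symbol u (2 * Real.pi * ξ) * ρ ξ) (cocompact ℝ) (𝓝 0) := by
  set s : Set ℝ := Set.Ioo (-(Real.pi / 2)) (Real.pi / 2)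
  set f : ℝ → ℝ := fun θ => Real.tan θ / (4 * Real.pi) with hf
  set f' : ℝ → ℝ := fun θ => 1 / Real.cos θ ^ 2 / (4 * Real.pi)
  have hms : MeasurableSet s := measurableSet_Ioo
  have hpi : (4 * Real.pi) ≠ 0 := by positivity
  have himage : f '' s = Set.univ := by
    refine Set.eq_univ_of_forall fun ξ => ⟨Real.arctan (4 * Real.pi * ξ), ?_, ?_⟩
    · exact Real.arctan_mem_Ioo _
    · simp only [hf, Real.tan_arctan]
      field_simp
  have hderiv : ∀ θ ∈ s, HasDerivWithinAt f (f' θ) s θ := fun θ hθ =>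
    ((Real.hasDerivAt_tan_of_mem_Ioo hθ).div_const _).hasDerivWithinAt
  have hinj : Set.InjOn f s := fun a ha b hb hab =>
    Real.injOn_tan ha hb ((div_left_inj' hpi).1 hab)
  have hRL := (Real.tendsto_integral_exp_smul_cocompact
    (s.indicator fun θ => ((|f' θ| : ℝ) : ℂ) * ρ (f θ))).comp
    (Homeomorph.mulRight₀ (Real.pi⁻¹) (by positivity)).isClosedEmbedding.tendsto_cocompact
  refine hRL.congr fun u => ?_
  have h1 := integral_image_eq_integral_abs_deriv_smul hms hderiv hinj
    (fun ξ : ℝ => symbol u (2 * Real.pi * ξ) * ρ ξ)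
  rw [himage, setIntegral_univ] at h1
  rw [h1, ← integral_indicator hms]
  simp only [Function.comp_apply, Homeomorph.coe_mulRight₀]
  refine integral_congr_ae (.of_forall fun θ => ?_)
  by_cases hθ : θ ∈ s
  · simp only [Set.indicator_of_mem hθ]
    have h2 : 2 * (2 * Real.pi * f θ) = Real.tan θ := by
      simp only [hf]
      field_simp
      ring
    rw [symbol_eq, h2, Real.arctan_tan hθ.1 hθ.2, Circle.smul_def, Real.fourierChar_apply,
      Complex.real_smul, smul_eq_mul]
    have h3 : 2 * Real.pi * -(θ * (u * Real.pi⁻¹)) = -2 * u * θ := by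
      field_simp
    rw [h3]
    ring
  · simp only [Set.indicator_of_notMem hθ, smul_zero]

/-! ### The flow on `H^U` -/

/-- The group `𝒮` on `H^U`: the Fourier multipliers commute with `h ↦ h' + h / 2`, through which
they are transported from `L²(ℝ)`. -/
def flow (u : ℝ) : HU ≃ₗᵢ[ℝ] HU := (HU.drift.trans (rotate u)).trans HU.drift.symm

lemma drift_flow (u : ℝ) (h : HU) : HU.drift (flow u h) = rotate u (HU.drift h) :=
  HU.drift.apply_symm_apply _

lemma isFourierMultiplier_flow (u : ℝ) : IsFourierMultiplier (symbol u) (flow u) := by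
  intro h
  have h1 := HU.fourierReal_drift (flow u h)
  rw [drift_flow] at h1
  filter_upwards [h1, fourierReal_rotate u (HU.drift h), HU.fourierReal_drift h] with ξ h1 h2 h3
  refine mul_left_cancel₀ (half_add_mul_I_ne_zero ξ) ?_
  rw [← h1, h2, h3]
  ring

lemma IsFourierMultiplier.unique {m : ℝ → ℂ} {A B : HU → HU} (hA : IsFourierMultiplier m A)
    (hB : IsFourierMultiplier m B) : A = B := by
  funext h
  refine HU.fourier_ext ?_
  filter_upwards [hA h, hB h] with ξ h1 h2
  rw [h1, h2]

lemma flow_zero (h : HU) : flow 0 h = h :=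
  HU.drift.injective (by rw [drift_flow]; exact rotateFun_zero _)

lemma flow_add (u v : ℝ) (h : HU) : flow (u + v) h = flow u (flow v h) :=
  HU.drift.injective (by rw [drift_flow, drift_flow, drift_flow]; exact rotateFun_add _ _ _)

lemma flow_symm (u : ℝ) (h : HU) : (flow u).symm h = flow (-u) h := by
  rw [LinearIsometryEquiv.symm_apply_eq, ← flow_add, add_neg_cancel, flow_zero]

lemma inner_flow (u : ℝ) (g h : HU) : ⟪g, flow u h⟫ =
    (∫ ξ : ℝ, symbol u (2 * Real.pi * ξ) * crossDensity (HU.drift g) (HU.drift h) ξ).re := by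
  rw [← inner_rotate, ← drift_flow, HU.drift.inner_map_map]

lemma continuous_inner_flow (g h : HU) : Continuous fun u : ℝ => ⟪g, flow u h⟫ := by
  simp only [inner_flow]
  exact Complex.continuous_re.comp (continuous_integral_symbol_mul (integrable_crossDensity _ _))

lemma tendsto_inner_flow (g h : HU) :
    Tendsto (fun u : ℝ => ⟪g, flow u h⟫) (cocompact ℝ) (𝓝 0) := by
  simp only [inner_flow]
  have := (Complex.continuous_re.tendsto 0).comp
    (tendsto_integral_symbol_mul (crossDensity (HU.drift g) (HU.drift h)))
  rwa [Complex.zero_re] at this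

/-- Weak continuity of a group of isometries implies strong continuity. -/
lemma continuous_flow (h : HU) : Continuous fun u : ℝ => flow u h := by
  rw [continuous_iff_continuousAt]
  intro v
  rw [ContinuousAt, tendsto_iff_norm_sub_tendsto_zero]
  have h1 : ∀ u, ‖flow u h - flow v h‖ =
      Real.sqrt (2 * ‖h‖ ^ 2 - 2 * ⟪flow v h, flow u h⟫) := by
    intro u
    rw [← Real.sqrt_sq (norm_nonneg (flow u h - flow v h)), norm_sub_sq_real,
      LinearIsometryEquiv.norm_map, LinearIsometryEquiv.norm_map, real_inner_comm]
    ring_nf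
  simp only [h1]
  have h2 : Continuous fun u => Real.sqrt (2 * ‖h‖ ^ 2 - 2 * ⟪flow v h, flow u h⟫) := by
    have := continuous_inner_flow (flow v h) h
    fun_prop
  have h3 := h2.tendsto v
  rw [real_inner_self_eq_norm_sq, LinearIsometryEquiv.norm_map] at h3
  simpa using h3

/-- At time `1` the flow is `h ↦ w - h`, where `w' + w / 2 = h`: the symbol of `h ↦ w` is
`1 / (1/2 + iλ)`. -/
lemma flow_one_apply (h : HU) : flow 1 h = HU.drift.symm h.toL2 - h := by
  set w := HU.drift.symm h.toL2 with hw
  have h1 := HU.fourierReal_drift w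
  rw [hw, LinearIsometryEquiv.apply_symm_apply, ← HU.fourier_eq, ← hw] at h1
  have h2 : (w - h).toL2 = w.toL2 - h.toL2 := MemLp.toLp_sub w.memLp h.memLp
  refine HU.fourier_ext ?_
  rw [(w - h).fourier_eq, h2, map_sub, ← HU.fourier_eq, ← HU.fourier_eq]
  filter_upwards [h1, isFourierMultiplier_flow 1 h, Lp.coeFn_sub w.fourier h.fourier]
    with ξ h3 h4 h5
  rw [h4, h5, Pi.sub_apply]
  refine mul_left_cancel₀ (half_add_mul_I_ne_zero ξ) ?_
  rw [mul_sub, ← h3]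
  have h6 := mul_symbol_one (2 * Real.pi * ξ)
  push_cast at h6
  linear_combination h.fourier ξ * h6

/-! ### The Jeulin–Yor transformation -/

/-- The Jeulin–Yor transformation of `H¹₀`. -/
def jeulinYor : H10 ≃ₗᵢ[ℝ] H10 :=
  ((H10.transport.trans (flow 1)).trans H10.transport.symm).trans (LinearIsometryEquiv.neg ℝ)

lemma jeulinYor_apply (g : H10) :
    jeulinYor g = -H10.transport.symm (flow 1 (H10.transport g)) := rfl

lemma isJeulinYor_jeulinYor : IsJeulinYor jeulinYor := by
  intro g t ht
  rw [← H10.transport_symm_drift_symm_apply g ht, jeulinYor_apply, flow_one_apply, map_sub,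
    LinearIsometryEquiv.symm_apply_apply, neg_sub]
  rfl

lemma flow_one_eq_neg_transport (h : HU) :
    flow 1 h = -H10.transport (jeulinYor (H10.transport.symm h)) := by
  rw [jeulinYor_apply, LinearIsometryEquiv.apply_symm_apply, map_neg,
    LinearIsometryEquiv.apply_symm_apply, neg_neg]

/-! ### The path space is Polish -/

/-- Extension by `0` at infinity, from `C₀(ℝ)` to the continuous functions on the one-point
compactification. -/
def extendOnePoint (f : C₀(ℝ, ℝ)) : C(OnePoint ℝ, ℝ) :=
  OnePoint.continuousMapMk f 0 (by
    rw [coclosedCompact_eq_cocompact]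
    exact f.zero_at_infty')

lemma isometry_extendOnePoint : Isometry extendOnePoint := by
  refine Isometry.of_dist_eq fun f g => le_antisymm ?_ ?_
  · refine (ContinuousMap.dist_le dist_nonneg).2 fun x => ?_
    induction x using OnePoint.rec with
    | infty =>
      change dist (0 : ℝ) 0 ≤ _
      rw [dist_self]
      exact dist_nonneg
    | coe x =>
      change dist (f x) (g x) ≤ _
      rw [← ZeroAtInftyContinuousMap.dist_toBCF_eq_dist]
      exact BoundedContinuousFunction.dist_coe_le_dist (f := f.toBCF) (g := g.toBCF) x
  · rw [← ZeroAtInftyContinuousMap.dist_toBCF_eq_dist]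
    refine (BoundedContinuousFunction.dist_le dist_nonneg).2 fun x => ?_
    exact ContinuousMap.dist_apply_le_dist (f := extendOnePoint f) (g := extendOnePoint g)
      (x : OnePoint ℝ)

instance : SecondCountableTopology (OnePoint ℝ) :=
  (onePointEquivSphereOfFinrankEq (ι := Fin 2) (V := ℝ) (by simp)).secondCountableTopology

instance : SecondCountableTopology C₀(ℝ, ℝ) :=
  isometry_extendOnePoint.isEmbedding.secondCountableTopology

namespace UPath

lemma isometry_toC0 : Isometry toC0 := AddMonoidHomClass.isometry_of_norm toC0 fun _ => rfl

lemma surjective_toC0 : Function.Surjective toC0 := by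
  intro φ
  have hw : Continuous fun t : ℝ => Real.log (Real.exp 1 + |t|) :=
    Continuous.log (by fun_prop) fun t => by positivity
  refine ⟨⟨fun t => φ t * Real.log (Real.exp 1 + |t|), φ.continuous.mul hw, ?_⟩, ?_⟩
  · have h1 : Tendsto (fun t => 2 * |φ t|) (cocompact ℝ) (𝓝 0) := by
      have := (φ.zero_at_infty'.abs).const_mul 2
      simpa using this
    refine tendsto_of_tendsto_of_tendsto_of_le_of_le' tendsto_const_nhds h1 ?_ ?_
    all_goals
      filter_upwards [(tendsto_norm_cocompact_atTop (E := ℝ)).eventually_gt_atTop (Real.exp 1)]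
        with t ht
      rw [Real.norm_eq_abs] at ht
      have he : 2 < Real.exp 1 := lt_trans (by norm_num) Real.exp_one_gt_d9
      have hl : 0 < Real.log |t| := Real.log_pos (by linarith)
    · positivity
    · rw [div_le_iff₀ hl, abs_mul, abs_of_pos (a := Real.log _) (by linarith [one_le_weight t])]
      -- `e + |t| ≤ 2 |t| ≤ |t|²` for `|t| > e`
      have h2 : Real.log (Real.exp 1 + |t|) ≤ 2 * Real.log |t| := by
        rw [← Nat.cast_ofNat, ← Real.log_pow]
        exact Real.log_le_log (by positivity) (by nlinarith)
      nlinarith [abs_nonneg (φ t)]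
  · ext t
    exact mul_div_cancel_right₀ (φ t) (weight_ne_zero t)

instance : CompleteSpace UPath :=
  (isometry_toC0.isUniformInducing.completeSpace_congr surjective_toC0).2 inferInstance

instance : SecondCountableTopology UPath := isometry_toC0.isEmbedding.secondCountableTopology

instance : PolishSpace UPath := inferInstance

lemma abs_apply_le (ω : UPath) (t : ℝ) : |ω t| ≤ Real.log (Real.exp 1 + |t|) * ‖ω‖ := by
  have h1 : ‖toC0 ω t‖ ≤ ‖ω‖ := (toC0 ω).toBCF.norm_coe_le_norm t
  have h2 : 0 < Real.log (Real.exp 1 + |t|) := by linarith [one_le_weight t]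
  rw [toC0_apply, norm_div, Real.norm_eq_abs, Real.norm_eq_abs, abs_of_pos h2, div_le_iff₀ h2] at h1
  linarith

/-- Evaluation at `t` as a continuous linear functional. -/
def evalCLM (t : ℝ) : StrongDual ℝ UPath :=
  LinearMap.mkContinuous
    { toFun := fun ω => ω t
      map_add' := fun _ _ => rfl
      map_smul' := fun _ _ => rfl } (Real.log (Real.exp 1 + |t|)) fun ω => abs_apply_le ω t

lemma continuous (ω : UPath) : Continuous ω := ω.2.1

/-- A path is determined by its values at rational times. -/
lemma ext_rat {ω ω' : UPath} (h : ∀ q : ℚ, ω q = ω' q) : ω = ω' :=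
  DFunLike.coe_injective (Rat.denseRange_cast.equalizer ω.continuous ω'.continuous (funext h))

/-- Restriction of paths to rational times. -/
def ratRestrict (ω : UPath) (q : ℚ) : ℝ := ω q

/-- By the Lusin–Souslin theorem, restriction to rational times identifies the path space with a
Borel subset of `ℝ^ℚ`. -/
lemma measurableEmbedding_ratRestrict : MeasurableEmbedding ratRestrict :=
  Continuous.measurableEmbedding (continuous_pi fun q => (evalCLM q).continuous)
    fun _ _ h => ext_rat (congrFun h)

end UPath

/-! ### Representing elements of `H^U` -/

lemma norm_incl_le (h : HU) : ‖incl h‖ ≤ ‖h‖ := by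
  rw [UPath.norm_def]
  refine Real.iSup_le (fun t => ?_) (norm_nonneg h)
  refine (div_le_self (abs_nonneg _) (UPath.one_le_weight t)).trans ?_
  exact h.abs_apply_le t

/-- The continuous inclusion of `H^U` in the path space. -/
def inclCLM : HU →L[ℝ] UPath :=
  incl.mkContinuous 1 fun h => by simpa using norm_incl_le h

/-- The map `x ↦ h_x` from the dual of the path space to `H^U`. -/
def rep : StrongDual ℝ UPath →ₗ[ℝ] HU where
  toFun x := (InnerProductSpace.toDual ℝ HU).symm (x.comp inclCLM)
  map_add' x y := by rw [ContinuousLinearMap.add_comp, map_add]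
  map_smul' c x := by rw [ContinuousLinearMap.smul_comp, map_smulₛₗ]; rfl

lemma represents_rep (x : StrongDual ℝ UPath) : Represents incl x (rep x) := by
  intro k
  rw [real_inner_comm]
  exact InnerProductSpace.toDual_symm_apply

lemma Represents.eq_rep {x : StrongDual ℝ UPath} {h : HU} (hx : Represents incl x h) :
    h = rep x :=
  ext_inner_left ℝ fun k => (hx k).trans (represents_rep x k).symm

lemma rep_evalCLM (t : ℝ) : rep (UPath.evalCLM t) = HU.evalRep t :=
  (Represents.eq_rep fun k => HU.inner_evalRep k t).symm

/-- The representing elements of the evaluations at rational times span a dense subspace. -/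
lemma topologicalClosure_span_evalRep :
    (Submodule.span ℝ (Set.range fun q : ℚ => HU.evalRep q)).topologicalClosure = ⊤ := by
  rw [Submodule.topologicalClosure_eq_top_iff, Submodule.eq_bot_iff]
  intro h hh
  have h1 : ∀ q : ℚ, h q = 0 := fun q => by
    rw [← HU.inner_evalRep]
    exact (Submodule.mem_orthogonal' _ _).1 hh _ (Submodule.subset_span ⟨q, rfl⟩)
  exact DFunLike.coe_injective (Rat.denseRange_cast.equalizer h.acl2.continuous continuous_zero
    (funext h1))

lemma denseRange_rep : DenseRange rep := by
  have h1 : Submodule.span ℝ (Set.range fun q : ℚ => HU.evalRep q) ≤ LinearMap.range rep :=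
    Submodule.span_le.2 (by
      rintro _ ⟨q, rfl⟩
      exact ⟨UPath.evalCLM q, rep_evalCLM q⟩)
  have h2 := Submodule.topologicalClosure_mono h1
  rw [topologicalClosure_span_evalRep, top_le_iff,
    ← Submodule.dense_iff_topologicalClosure_eq_top] at h2
  exact h2

/-! ### Uniqueness and composition of induced transformations -/

open Complex (I)

section PaleyWiener

variable {W : Measure UPath} {J : HU →ₗᵢ[ℝ] Lp ℝ 2 W} {O : HU ≃ₗᵢ[ℝ] HU} {T : UPath → UPath}

lemma IsPaleyWiener.unique {K : HU →ₗᵢ[ℝ] Lp ℝ 2 W} (hJ : IsPaleyWiener incl W J)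
    (hK : IsPaleyWiener incl W K) : J = K := by
  ext1 h
  refine denseRange_rep.induction_on (p := fun h => J h = K h) h
    (isClosed_eq J.continuous K.continuous) fun x => ?_
  exact Lp.ext ((hJ x _ (represents_rep x)).trans (hK x _ (represents_rep x)).symm)

lemma IsPaleyWiener.evalRep_ae (hJ : IsPaleyWiener incl W J) (t : ℝ) :
    J (HU.evalRep t) =ᵐ[W] fun ω => ω t := by
  rw [← rep_evalCLM]
  exact hJ _ _ (represents_rep _)

lemma IsInduced.apply_ae (hT : IsInduced J O T) (hJ : IsPaleyWiener incl W J) (t : ℝ) :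
    (fun ω => T ω t) =ᵐ[W] J (O.symm (HU.evalRep t)) :=
  hT.2 _ (fun ω => ω t) (hJ.evalRep_ae t).symm

lemma IsInduced.ae_eq {T' : UPath → UPath} (hT : IsInduced J O T) (hT' : IsInduced J O T')
    (hJ : IsPaleyWiener incl W J) : T =ᵐ[W] T' := by
  have h : ∀ᵐ ω ∂W, ∀ q : ℚ, T ω q = T' ω q :=
    ae_all_iff.2 fun q => (hT.apply_ae hJ q).trans (hT'.apply_ae hJ q).symm
  filter_upwards [h] with ω hω using UPath.ext_rat hω

lemma isInduced_id (hO : ∀ h, O h = h) : IsInduced J O id := by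
  refine ⟨measurable_id, fun h f hf => ?_⟩
  have : O.symm h = h := by rw [LinearIsometryEquiv.symm_apply_eq, hO]
  rw [this]
  exact hf

lemma IsInduced.comp {O₁ O₂ : HU ≃ₗᵢ[ℝ] HU} {T₁ T₂ : UPath → UPath} (h₁ : IsInduced J O₁ T₁)
    (h₂ : IsInduced J O₂ T₂) (hO : ∀ h, O h = O₁ (O₂ h)) : IsInduced J O (T₁ ∘ T₂) := by
  refine ⟨h₁.1.comp h₂.1, fun h f hf => ?_⟩
  have h3 : O.symm h = O₂.symm (O₁.symm h) := by
    rw [LinearIsometryEquiv.symm_apply_eq, hO, LinearIsometryEquiv.apply_symm_apply,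
      LinearIsometryEquiv.apply_symm_apply]
  rw [h3]
  exact h₂.2 _ _ (h₁.2 _ _ hf)

/-! ### The Paley–Wiener map -/

lemma IsWienerMeasure.map_dual (hW : IsWienerMeasure incl W) (x : StrongDual ℝ UPath) :
    W.map x = gaussianReal 0 (‖rep x‖₊ ^ 2) := hW x (rep x) (represents_rep x)

lemma IsWienerMeasure.memLp_dual (hW : IsWienerMeasure incl W) (x : StrongDual ℝ UPath) :
    MemLp x 2 W := by
  have h := memLp_id_gaussianReal' (μ := 0) (v := ‖rep x‖₊ ^ 2) 2 (by norm_num)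
  rw [← hW.map_dual x, memLp_map_measure_iff (by fun_prop) x.continuous.aemeasurable] at h
  exact h

lemma IsWienerMeasure.integral_dual (hW : IsWienerMeasure incl W) (x : StrongDual ℝ UPath) :
    ∫ ω, x ω ∂W = 0 := by
  have h := integral_map (μ := W) x.continuous.aemeasurable
    (f := id) (by fun_prop)
  rw [hW.map_dual x] at h
  exact h.symm.trans integral_id_gaussianReal

lemma IsWienerMeasure.integral_dual_sq (hW : IsWienerMeasure incl W) (x : StrongDual ℝ UPath) :
    ∫ ω, x ω ^ 2 ∂W = ‖rep x‖ ^ 2 := by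
  have h := variance_id_gaussianReal (μ := 0) (v := ‖rep x‖₊ ^ 2)
  rw [← hW.map_dual x, variance_map (by fun_prop) x.continuous.aemeasurable, Function.id_comp,
    variance_of_integral_eq_zero x.continuous.aemeasurable (hW.integral_dual x)] at h
  simpa using h

lemma IsWienerMeasure.isGaussian (hW : IsWienerMeasure incl W) : IsGaussian W where
  map_eq_gaussianReal x := by
    rw [hW.map_dual x, hW.integral_dual x,
      variance_of_integral_eq_zero x.continuous.aemeasurable (hW.integral_dual x),
      hW.integral_dual_sq x]
    congr 1
    ext
    simp

lemma IsWienerMeasure.integral_cexp_dual (hW : IsWienerMeasure incl W) (x : StrongDual ℝ UPath) :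
    ∫ ω, Complex.exp (x ω * I) ∂W = Complex.exp (-(‖rep x‖ ^ 2 / 2 : ℝ)) := by
  have h := charFun_gaussianReal (μ := 0) (v := ‖rep x‖₊ ^ 2) 1
  rw [← hW.map_dual x, charFun_apply_real, integral_map x.continuous.aemeasurable
    (by fun_prop)] at h
  simp only [Complex.ofReal_one, one_mul] at h
  rw [h]
  congr 1
  push_cast
  simp

/-- Continuous linear functionals as square-integrable random variables. -/
def dualToLp (hW : IsWienerMeasure incl W) : StrongDual ℝ UPath →ₗ[ℝ] Lp ℝ 2 W where
  toFun x := (hW.memLp_dual x).toLp x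
  map_add' x y := MemLp.toLp_add (hW.memLp_dual x) (hW.memLp_dual y)
  map_smul' c x := MemLp.toLp_const_smul c (hW.memLp_dual x)

lemma coeFn_dualToLp (hW : IsWienerMeasure incl W) (x : StrongDual ℝ UPath) :
    dualToLp hW x =ᵐ[W] x := (hW.memLp_dual x).coeFn_toLp

lemma norm_dualToLp (hW : IsWienerMeasure incl W) (x : StrongDual ℝ UPath) :
    ‖dualToLp hW x‖ = ‖rep x‖ := by
  refine (sq_eq_sq₀ (norm_nonneg _) (norm_nonneg _)).1 ?_
  rw [← real_inner_self_eq_norm_sq, L2.inner_def, ← hW.integral_dual_sq]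
  refine integral_congr_ae ?_
  filter_upwards [coeFn_dualToLp hW x] with ω hω
  rw [hω]
  simp [sq]

/-- The Paley–Wiener map, the isometric extension of `h_x ↦ x`. -/
def paleyWiener (hW : IsWienerMeasure incl W) : HU →ₗᵢ[ℝ] Lp ℝ 2 W where
  toLinearMap := ((dualToLp hW).extendOfNorm rep).toLinearMap
  norm_map' h := by
    refine denseRange_rep.induction_on (p := fun h => ‖(dualToLp hW).extendOfNorm rep h‖ = ‖h‖) h
      (isClosed_eq (by fun_prop) (by fun_prop)) fun x => ?_
    rw [LinearMap.extendOfNorm_eq denseRange_rep ⟨1, fun x => ?_⟩, norm_dualToLp]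
    rw [norm_dualToLp, one_mul]

lemma paleyWiener_rep (hW : IsWienerMeasure incl W) (x : StrongDual ℝ UPath) :
    paleyWiener hW (rep x) = dualToLp hW x :=
  LinearMap.extendOfNorm_eq denseRange_rep ⟨1, fun x => by rw [norm_dualToLp, one_mul]⟩ x

lemma isPaleyWiener_paleyWiener (hW : IsWienerMeasure incl W) :
    IsPaleyWiener incl W (paleyWiener hW) := by
  intro x h hx
  rw [hx.eq_rep, paleyWiener_rep]
  exact coeFn_dualToLp hW x

lemma IsWienerMeasure.isOrnsteinUhlenbeckLaw (hW : IsWienerMeasure incl W) :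
    IsOrnsteinUhlenbeckLaw W := by
  refine ⟨⟨fun J => ?_⟩, fun t => hW.integral_dual (UPath.evalCLM t), fun s t => ?_⟩
  · have := hW.isGaussian
    exact (IsGaussian.hasGaussianLaw_id (μ := W)).map
      (ContinuousLinearMap.pi fun t : J => UPath.evalCLM t)
  · have hJ := isPaleyWiener_paleyWiener hW
    rw [← HU.inner_evalRep_evalRep, ← (paleyWiener hW).inner_map_map, L2.inner_def]
    refine integral_congr_ae ?_
    filter_upwards [hJ.evalRep_ae s, hJ.evalRep_ae t] with ω h1 h2
    rw [h1, h2]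
    simp [mul_comm]

variable [IsProbabilityMeasure W]

/-! ### Exponentials of Gaussian variables -/

lemma integral_abs_le_norm {Ω : Type*} [MeasurableSpace Ω] {P : Measure Ω} [IsProbabilityMeasure P]
    (f : Lp ℝ 2 P) : ∫ ω, |f ω| ∂P ≤ ‖f‖ := by
  have h := eLpNorm_le_eLpNorm_of_exponent_le (p := 1) (q := 2) (by norm_num)
    (Lp.aestronglyMeasurable f)
  have h1 := ENNReal.toReal_mono (Lp.eLpNorm_ne_top f) h
  rw [eLpNorm_one_eq_lintegral_enorm, ← integral_norm_eq_lintegral_enorm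
    (Lp.aestronglyMeasurable f)] at h1
  exact h1

lemma norm_cexp_mul_I_sub_le (a b : ℝ) :
    ‖Complex.exp (a * I) - Complex.exp (b * I)‖ ≤ |a - b| := by
  have h1 : Complex.exp (a * I) - Complex.exp (b * I) =
      Complex.exp (b * I) * (Complex.exp (I * (a - b : ℝ)) - 1) := by
    rw [mul_sub, ← Complex.exp_add, mul_one]
    push_cast
    ring_nf
  rw [h1, norm_mul, Complex.norm_exp_ofReal_mul_I, one_mul]
  exact Real.norm_exp_I_mul_ofReal_sub_one_le

section Abstract

variable {Ω : Type*} [MeasurableSpace Ω] {P : Measure Ω} [IsProbabilityMeasure P]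

lemma memLp_cexp (f : Lp ℝ 2 P) (p : ℝ≥0∞) : MemLp (fun ω => Complex.exp (f ω * I)) p P := by
  have hm : AEStronglyMeasurable (fun ω => Complex.exp (f ω * I)) P :=
    (by fun_prop : Continuous fun x : ℝ => Complex.exp (x * I)).comp_aestronglyMeasurable
      (Lp.aestronglyMeasurable f)
  exact MemLp.of_bound hm 1 (.of_forall fun ω => (Complex.norm_exp_ofReal_mul_I _).le)

lemma integrable_cexp (f : Lp ℝ 2 P) : Integrable (fun ω => Complex.exp (f ω * I)) P :=
  memLp_one_iff_integrable.1 (memLp_cexp f 1)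

lemma continuous_integral_cexp :
    Continuous fun f : Lp ℝ 2 P => ∫ ω, Complex.exp (f ω * I) ∂P := by
  refine LipschitzWith.continuous (K := 1) (LipschitzWith.of_dist_le_mul fun f g => ?_)
  rw [NNReal.coe_one, one_mul, dist_eq_norm, dist_eq_norm,
    ← integral_sub (integrable_cexp f) (integrable_cexp g)]
  refine (norm_integral_le_integral_norm _).trans (le_trans ?_ (integral_abs_le_norm (f - g)))
  refine integral_mono_ae ((integrable_cexp f).sub (integrable_cexp g)).norm
    ((Lp.memLp (f - g)).integrable (by norm_num)).abs ?_
  filter_upwards [Lp.coeFn_sub f g] with ω hω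
  rw [hω]
  exact norm_cexp_mul_I_sub_le _ _

end Abstract

lemma IsPaleyWiener.integral_cexp (hJ : IsPaleyWiener incl W J) (hW : IsWienerMeasure incl W)
    (h : HU) : ∫ ω, Complex.exp (J h ω * I) ∂W = Complex.exp (-(‖h‖ ^ 2 / 2 : ℝ)) := by
  refine denseRange_rep.induction_on (p := fun h => ∫ ω, Complex.exp (J h ω * I) ∂W =
    Complex.exp (-(‖h‖ ^ 2 / 2 : ℝ))) h
    (isClosed_eq (continuous_integral_cexp.comp J.continuous) (by fun_prop)) fun x => ?_
  rw [← hW.integral_cexp_dual]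
  refine integral_congr_ae ?_
  filter_upwards [hJ x _ (represents_rep x)] with ω hω
  rw [hω]

/-! ### Transformations of the path space induced by orthogonal transformations -/

/-- The law of the process `(I(U h_q))_q`, `h_q` representing evaluation at a rational time `q`,
does not depend on the isometry `U`. -/
lemma IsPaleyWiener.map_eq_map_ratRestrict (hJ : IsPaleyWiener incl W J)
    (hW : IsWienerMeasure incl W) (U : HU →ₗᵢ[ℝ] HU) {X : ℚ → UPath → ℝ}
    (hX : ∀ q, Measurable (X q)) (hXU : ∀ q : ℚ, X q =ᵐ[W] J (U (HU.evalRep q))) :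
    W.map (fun ω q => X q ω) = W.map UPath.ratRestrict := by
  -- the characteristic functions of the finite-dimensional laws
  have key : ∀ (V : HU →ₗᵢ[ℝ] HU) (Y : ℚ → UPath → ℝ), (∀ q, Measurable (Y q)) →
      (∀ q : ℚ, Y q =ᵐ[W] J (V (HU.evalRep q))) → ∀ (s : Finset ℚ) (L : StrongDual ℝ (s → ℝ)),
      charFunDual (W.map fun ω => s.restrict (Y · ω)) L =
        Complex.exp (-(‖∑ q : s, L (Pi.single q 1) • HU.evalRep (q : ℚ)‖ ^ 2 / 2 : ℝ)) := by
    intro V Y hY hYV s L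
    have hm : Measurable fun ω => s.restrict (Y · ω) := measurable_pi_lambda _ fun q => hY q
    rw [charFunDual_apply, integral_map hm.aemeasurable (by fun_prop), ← V.norm_map,
      ← hJ.integral_cexp hW]
    refine integral_congr_ae ?_
    rw [map_sum, map_sum]
    have h1 : ∀ᵐ ω ∂W, ∀ q : s, J (V (L (Pi.single q 1) • HU.evalRep (q : ℚ))) ω =
        L (Pi.single q 1) * Y q ω := by
      rw [ae_all_iff]
      intro q
      rw [map_smul, map_smul]
      filter_upwards [hYV q, Lp.coeFn_smul (L (Pi.single q 1)) (J (V (HU.evalRep (q : ℚ))))]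
        with ω h1 h2
      rw [h2, Pi.smul_apply, h1, smul_eq_mul]
    filter_upwards [h1, Lp.coeFn_finsetSum Finset.univ
      fun q : s => J (V (L (Pi.single q 1) • HU.evalRep (q : ℚ)))] with ω h2 h3
    rw [h3, Finset.sum_apply, Finset.sum_congr rfl fun q _ => h2 q]
    congr 3
    refine (LinearMap.pi_apply_eq_sum_univ L.toLinearMap (s.restrict (Y · ω))).trans ?_
    refine Finset.sum_congr rfl fun q _ => ?_
    rw [smul_eq_mul, mul_comm]
    exact congrArg (· * Y q ω) (congrArg L (funext fun j => by simp [Pi.single_apply, eq_comm]))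
  have hr : ∀ q : ℚ, Measurable fun ω : UPath => ω (q : ℝ) := fun q =>
    (UPath.evalCLM q).continuous.measurable
  refine (map_eq_iff_forall_finset_map_restrict_eq (X := X) (Y := fun (q : ℚ) (ω : UPath) => ω q)
    (measurable_pi_lambda _ hX).aemeasurable (measurable_pi_lambda _ hr).aemeasurable).2 fun s => ?_
  have h1 : IsProbabilityMeasure (W.map fun ω => s.restrict (X · ω)) :=
    Measure.isProbabilityMeasure_map
      (measurable_pi_lambda _ fun q : s => hX q).aemeasurable
  have h2 : IsProbabilityMeasure
      (W.map fun ω => s.restrict ((fun (q : ℚ) (ω : UPath) => ω q) · ω)) :=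
    Measure.isProbabilityMeasure_map
      (measurable_pi_lambda _ fun q : s => hr q).aemeasurable
  refine Measure.ext_of_charFunDual (funext fun L => ?_)
  rw [key U X hX hXU s L, key LinearIsometry.id _ hr (fun q => (hJ.evalRep_ae q).symm) s L]

lemma measurePreserving_of_apply_ae (hJ : IsPaleyWiener incl W J) (hW : IsWienerMeasure incl W)
    (hTm : Measurable T) (hT : ∀ q : ℚ, (fun ω => T ω q) =ᵐ[W] J (O.symm (HU.evalRep q))) :
    MeasurePreserving T W W := by
  refine ⟨hTm, ?_⟩
  have h := hJ.map_eq_map_ratRestrict hW O.symm.toLinearIsometry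
    (X := fun q ω => T ω q) (fun q => (UPath.evalCLM q).continuous.measurable.comp hTm) hT
  have hr := UPath.measurableEmbedding_ratRestrict
  have h1 : (W.map T).map UPath.ratRestrict = W.map UPath.ratRestrict := by
    rw [Measure.map_map hr.measurable hTm]
    exact h
  rw [← hr.comap_map (W.map T), h1, hr.comap_map]

/-- It suffices to check the defining relation of an induced transformation for evaluations at
rational times: `T` then preserves `W`, so composition with `T` is an isometry of `L²(W)`. -/
lemma isInduced_of_apply_ae (hJ : IsPaleyWiener incl W J) (hW : IsWienerMeasure incl W)
    (hTm : Measurable T) (hT : ∀ q : ℚ, (fun ω => T ω q) =ᵐ[W] J (O.symm (HU.evalRep q))) :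
    IsInduced J O T := by
  have hmp := measurePreserving_of_apply_ae hJ hW hTm hT
  refine ⟨hTm, fun h f hf => ?_⟩
  have h1 : ((Lp.compMeasurePreservingₗᵢ ℝ T hmp).comp J).toContinuousLinearMap =
      (J.comp O.symm.toLinearIsometry).toContinuousLinearMap := by
    refine ContinuousLinearMap.ext_on (s := Set.range fun q : ℚ => HU.evalRep q)
      ((Submodule.dense_iff_topologicalClosure_eq_top).2 topologicalClosure_span_evalRep) ?_
    rintro _ ⟨q, rfl⟩
    refine Lp.ext ?_
    have h2 : (J (HU.evalRep q) : UPath → ℝ) ∘ T =ᵐ[W] fun ω => T ω q :=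
      hmp.quasiMeasurePreserving.ae_eq_comp (hJ.evalRep_ae q)
    exact (Lp.coeFn_compMeasurePreserving (J (HU.evalRep q)) hmp).trans (h2.trans (hT q))
  have h2 : Lp.compMeasurePreserving T hmp (J h) = J (O.symm h) := DFunLike.congr_fun h1 h
  rw [← h2]
  exact (hmp.quasiMeasurePreserving.ae_eq_comp hf).trans
    (Lp.coeFn_compMeasurePreserving (J h) hmp).symm

/-- The process `(I(Oᵀ h_q))_q` has the law of the restriction of the paths to the rational times,
hence almost surely extends to a path. -/
lemma exists_isInduced (hJ : IsPaleyWiener incl W J) (hW : IsWienerMeasure incl W)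
    (O : HU ≃ₗᵢ[ℝ] HU) : ∃ T, IsInduced J O T := by
  have hr := UPath.measurableEmbedding_ratRestrict
  obtain ⟨g, hg, hgr⟩ := hr.exists_measurable_extend measurable_id fun _ => ⟨0⟩
  set X : UPath → ℚ → ℝ := fun ω q => J (O.symm (HU.evalRep q)) ω
  have hXq : ∀ q : ℚ, Measurable fun ω => X ω q := fun q => (Lp.stronglyMeasurable _).measurable
  have hXm : Measurable X := measurable_pi_lambda _ hXq
  have h := hJ.map_eq_map_ratRestrict hW O.symm.toLinearIsometry
    (X := fun q ω => X ω q) hXq fun q => .rfl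
  have h1 : ∀ᵐ y ∂(W.map UPath.ratRestrict), UPath.ratRestrict (g y) = y := by
    refine (ae_map_iff hr.measurable.aemeasurable
      (measurableSet_eq_fun (hr.measurable.comp hg) measurable_id)).2 (.of_forall fun ω => ?_)
    have := congrFun hgr ω
    exact congrArg UPath.ratRestrict this
  rw [← h] at h1
  have h2 : ∀ᵐ ω ∂W, UPath.ratRestrict (g (X ω)) = X ω := ae_of_ae_map hXm.aemeasurable h1
  refine ⟨fun ω => g (X ω), isInduced_of_apply_ae hJ hW (hg.comp hXm) fun q => ?_⟩
  filter_upwards [h2] with ω hω using congrFun hω q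

lemma IsInduced.measurePreserving (hT : IsInduced J O T) (hJ : IsPaleyWiener incl W J)
    (hW : IsWienerMeasure incl W) : MeasurePreserving T W W :=
  measurePreserving_of_apply_ae hJ hW hT.1 fun q => hT.apply_ae hJ q

/-! ### Ergodicity -/

/-- A bounded sequence whose inner products with each of its terms tend to zero converges weakly
to zero. -/
lemma tendsto_inner_of_tendsto_inner_self {𝕜 E : Type*} [RCLike 𝕜] [NormedAddCommGroup E]
    [InnerProductSpace 𝕜 E] [CompleteSpace E] {v : ℕ → E} {C : ℝ} (hC : ∀ n, ‖v n‖ ≤ C)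
    (hv : ∀ m, Tendsto (fun n => inner 𝕜 (v m) (v n)) atTop (𝓝 0)) (f : E) :
    Tendsto (fun n => inner 𝕜 f (v n)) atTop (𝓝 0) := by
  let K : Submodule 𝕜 E :=
    { carrier := {g | Tendsto (fun n => inner 𝕜 g (v n)) atTop (𝓝 0)}
      add_mem' := fun {a b} ha hb => by
        have := Tendsto.add ha hb
        simpa [inner_add_left] using this
      zero_mem' := by simp
      smul_mem' := fun c a ha => by
        have := Tendsto.const_mul (starRingEnd 𝕜 c) ha
        simpa [inner_smul_left] using this }
  have hK : IsClosed (K : Set E) := by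
    refine isClosed_of_closure_subset fun g hg => ?_
    change Tendsto (fun n => inner 𝕜 g (v n)) atTop (𝓝 0)
    have hC0 : 0 ≤ C := (norm_nonneg _).trans (hC 0)
    rw [Metric.tendsto_atTop]
    intro ε hε
    obtain ⟨g', hg', hgg⟩ := Metric.mem_closure_iff.1 hg (ε / 2 / (C + 1)) (by positivity)
    obtain ⟨N, hN⟩ := Metric.tendsto_atTop.1 hg' (ε / 2) (by positivity)
    refine ⟨N, fun n hn => ?_⟩
    have h1 := hN n hn
    rw [dist_zero_right] at h1 ⊢
    have h2 : inner 𝕜 g (v n) = inner 𝕜 (g - g') (v n) + inner 𝕜 g' (v n) := by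
      rw [← inner_add_left, sub_add_cancel]
    have h3 : ‖inner 𝕜 (g - g') (v n)‖ ≤ ε / 2 := by
      refine (norm_inner_le_norm _ _).trans ?_
      rw [← dist_eq_norm]
      calc dist g g' * ‖v n‖ ≤ ε / 2 / (C + 1) * (C + 1) := by
            gcongr
            linarith [hC n]
        _ = ε / 2 := by field_simp
    rw [h2]
    linarith [norm_add_le (inner 𝕜 (g - g') (v n)) (inner 𝕜 g' (v n))]
  have hKc : CompleteSpace K := hK.completeSpace_coe
  have h1 : f - K.starProjection f ∈ Kᗮ := K.sub_starProjection_mem_orthogonal f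
  have h2 : Tendsto (fun n => inner 𝕜 (K.starProjection f) (v n)) atTop (𝓝 0) :=
    K.starProjection_apply_mem f
  refine h2.congr fun n => ?_
  have h3 : inner 𝕜 (f - K.starProjection f) (v n) = 0 :=
    (K.mem_orthogonal' _).1 h1 _ (show v n ∈ K from hv n)
  rw [inner_sub_left, sub_eq_zero] at h3
  exact h3.symm

end PaleyWiener

section Ergodicity

variable {W : Measure UPath} {J : HU →ₗᵢ[ℝ] Lp ℝ 2 W} {O : HU ≃ₗᵢ[ℝ] HU} {T : UPath → UPath}

lemma IsInduced.setIntegral_cexp (hT : IsInduced J O T) (hmp : MeasurePreserving T W W)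
    {A : Set UPath} (hA : MeasurableSet A) (hinv : T ⁻¹' A = A) (h : HU) :
    ∫ ω in A, Complex.exp (J (O.symm h) ω * I) ∂W = ∫ ω in A, Complex.exp (J h ω * I) ∂W := by
  have hm : AEStronglyMeasurable (fun ω => Complex.exp (J h ω * I)) W :=
    (by fun_prop : Continuous fun x : ℝ => Complex.exp (x * I)).comp_aestronglyMeasurable
      (Lp.aestronglyMeasurable _)
  have h1 := setIntegral_map (μ := W) (g := T) (s := A)
    (f := fun ω => Complex.exp (J h ω * I)) hA (by rwa [hmp.map_eq]) hT.1.aemeasurable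
  rw [hmp.map_eq, hinv] at h1
  rw [h1]
  refine integral_congr_ae (ae_restrict_of_ae ?_)
  filter_upwards [hT.2 h _ .rfl] with ω hω
  rw [← hω]
  rfl

variable [IsProbabilityMeasure W]

/-- The exponential `e^{if}` as an element of `L²`. -/
def expLp (f : Lp ℝ 2 W) : Lp ℂ 2 W := (memLp_cexp f 2).toLp _

lemma coeFn_expLp (f : Lp ℝ 2 W) : expLp f =ᵐ[W] fun ω => Complex.exp (f ω * I) :=
  (memLp_cexp f 2).coeFn_toLp

lemma IsPaleyWiener.inner_expLp (hJ : IsPaleyWiener incl W J) (hW : IsWienerMeasure incl W)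
    (h k : HU) :
    inner ℂ (expLp (J h)) (expLp (J k)) = Complex.exp (-(‖k - h‖ ^ 2 / 2 : ℝ)) := by
  rw [L2.inner_def, ← hJ.integral_cexp hW]
  refine integral_congr_ae ?_
  rw [map_sub]
  filter_upwards [coeFn_expLp (J h), coeFn_expLp (J k), Lp.coeFn_sub (J k) (J h)] with ω h1 h2 h3
  rw [h1, h2, h3, RCLike.inner_apply, ← Complex.exp_conj, ← Complex.exp_add, map_mul,
    Complex.conj_ofReal, Complex.conj_I, Pi.sub_apply]
  congr 1
  push_cast
  ring

/-- If `h_n` has constant norm and `(h_m, h_n) → 0`, then the variables `e^{iI(h_n)}` converge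
weakly to their common mean. -/
lemma IsPaleyWiener.tendsto_setIntegral_cexp (hJ : IsPaleyWiener incl W J)
    (hW : IsWienerMeasure incl W) {h : ℕ → HU} {r : ℝ} (hr : ∀ n, ‖h n‖ = r)
    (hh : ∀ m, Tendsto (fun n => ⟪h m, h n⟫) atTop (𝓝 0)) {A : Set UPath} (hA : MeasurableSet A) :
    Tendsto (fun n => ∫ ω in A, Complex.exp (J (h n) ω * I) ∂W) atTop
      (𝓝 (Complex.exp (-(r ^ 2 / 2 : ℝ)) * W.real A)) := by
  set c : ℂ := Complex.exp (-(r ^ 2 / 2 : ℝ)) with hc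
  have hcc : starRingEnd ℂ c = c := by
    rw [hc, ← Complex.exp_conj, map_neg, Complex.conj_ofReal]
  set v : ℕ → Lp ℂ 2 W := fun n => expLp (J (h n)) - c • expLp (J 0) with hv
  have hnorm : ∀ k : HU, ‖expLp (J k)‖ = 1 := fun k => by
    have h2 : ‖expLp (J k)‖ ^ 2 = 1 := by
      rw [← inner_self_eq_norm_sq (𝕜 := ℂ), hJ.inner_expLp hW]
      simp
    exact (pow_eq_one_iff_of_nonneg (norm_nonneg _) two_ne_zero).1 h2
  have hbound : ∀ n, ‖v n‖ ≤ 1 + ‖c‖ := fun n => by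
    refine (norm_sub_le _ _).trans ?_
    rw [norm_smul, hnorm, hnorm, mul_one]
  have hinner : ∀ m n, inner ℂ (v m) (v n) = Complex.exp (-(r ^ 2 - ⟪h m, h n⟫ : ℝ)) - c * c := by
    intro m n
    have h1 : ‖h n - h m‖ ^ 2 / 2 = r ^ 2 - ⟪h m, h n⟫ := by
      rw [norm_sub_sq_real, hr, hr, real_inner_comm]
      ring
    simp only [hv, inner_sub_left, inner_sub_right, inner_smul_left, inner_smul_right,
      hJ.inner_expLp hW, hcc, h1, sub_zero, zero_sub, norm_neg, hr, norm_zero]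
    rw [← hc]
    simp
  have hlim : ∀ m, Tendsto (fun n => inner ℂ (v m) (v n)) atTop (𝓝 0) := by
    intro m
    simp only [hinner]
    have h1 : Continuous fun x : ℝ => Complex.exp (-(r ^ 2 - x : ℝ)) - c * c := by fun_prop
    have h2 := (h1.tendsto 0).comp (hh m)
    have h3 : Complex.exp (-(r ^ 2 - 0 : ℝ)) - c * c = 0 := by
      rw [hc, ← Complex.exp_add, sub_eq_zero]
      congr 1
      push_cast
      ring
    rwa [h3] at h2
  have h1 := tendsto_inner_of_tendsto_inner_self hbound hlim
    (indicatorConstLp 2 hA (measure_ne_top W A) (1 : ℂ))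
  have hset : ∀ k : HU, inner ℂ (indicatorConstLp 2 hA (measure_ne_top W A) (1 : ℂ))
      (expLp (J k)) = ∫ ω in A, Complex.exp (J k ω * I) ∂W := fun k => by
    rw [L2.inner_indicatorConstLp_one]
    exact integral_congr_ae (ae_restrict_of_ae (coeFn_expLp (J k)))
  have hzero : ∫ ω in A, Complex.exp (J 0 ω * I) ∂W = W.real A := by
    have h2 : ∀ᵐ ω ∂W, Complex.exp (J 0 ω * I) = 1 := by
      rw [map_zero]
      filter_upwards [Lp.coeFn_zero ℝ 2 W] with ω hω
      rw [hω]
      simp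
    rw [integral_congr_ae (ae_restrict_of_ae h2)]
    simp
  simp only [hv, inner_sub_right, inner_smul_right, hset, hzero] at h1
  simpa using h1.add_const (c * W.real A)

/-- For an invariant set `A`, the numbers `∫_A e^{iI(𝒮^{-nu} h)} dW` do not depend on `n`, while
decay of the matrix coefficients makes them converge to `W(A) ∫ e^{iI(h)} dW`. Hence the
restriction of `W` to `A` has the same characteristic function as `W(A) W`. -/
lemma IsInduced.ergodic {u : ℝ} (hu : u ≠ 0) (hT : IsInduced J (flow u) T)
    (hJ : IsPaleyWiener incl W J) (hW : IsWienerMeasure incl W) : Ergodic T W := by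
  have hmp := hT.measurePreserving hJ hW
  refine ⟨hmp, ⟨fun A hA hinv => ?_⟩⟩
  have key : ∀ h : HU, ∫ ω in A, Complex.exp (J h ω * I) ∂W =
      Complex.exp (-(‖h‖ ^ 2 / 2 : ℝ)) * W.real A := by
    intro h
    have hconst : ∀ n : ℕ, ∫ ω in A, Complex.exp (J (flow (-(n * u)) h) ω * I) ∂W =
        ∫ ω in A, Complex.exp (J h ω * I) ∂W := by
      intro n
      induction n with
      | zero => rw [Nat.cast_zero, zero_mul, neg_zero, flow_zero]
      | succ n ih =>
        rw [← ih, ← hT.setIntegral_cexp hmp hA hinv (flow (-(n * u)) h), flow_symm,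
          ← flow_add]
        have h1 : -(((n + 1 : ℕ) : ℝ) * u) = -u + -(n * u) := by
          push_cast
          ring
        rw [h1]
    have hlim : Tendsto (fun n : ℕ => -((n : ℝ) * u)) atTop (cocompact ℝ) := by
      have h1 : Tendsto (fun n : ℕ => (n : ℝ)) atTop (cocompact ℝ) :=
        tendsto_natCast_atTop_atTop.mono_right atTop_le_cocompact
      have h2 := (Homeomorph.mulRight₀ (-u) (neg_ne_zero.2 hu)).isClosedEmbedding.tendsto_cocompact
      refine (h2.comp h1).congr fun n => ?_
      simp
    have h1 := hJ.tendsto_setIntegral_cexp hW (h := fun n : ℕ => flow (-(n * u)) h)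
      (fun n => LinearIsometryEquiv.norm_map _ h)
      (fun m => (tendsto_inner_flow (flow (-(m * u)) h) h).comp hlim) hA
    simp only [hconst] at h1
    exact tendsto_nhds_unique tendsto_const_nhds h1
  have hres : W.restrict A = W A • W := by
    have : IsFiniteMeasure (W A • W) := Measure.smul_finite W (measure_ne_top W A)
    refine Measure.ext_of_charFunDual (funext fun x => ?_)
    have h1 : ∀ᵐ ω ∂W, Complex.exp (x ω * I) = Complex.exp (J (rep x) ω * I) := by
      filter_upwards [hJ x _ (represents_rep x)] with ω hω
      rw [hω]
    rw [charFunDual_apply, charFunDual_apply, integral_smul_measure, hW.integral_cexp_dual,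
      integral_congr_ae (ae_restrict_of_ae h1), key, mul_comm]
    rfl
  have h1 := congrArg (fun μ : Measure UPath => μ A) hres
  simp only [Measure.restrict_apply_self, Measure.smul_apply, smul_eq_mul] at h1
  refine eventuallyConst_set'.2 ?_
  rcases eq_or_ne (W A) 0 with h0 | h0
  · exact Or.inl (ae_eq_empty.2 h0)
  · right
    rw [ae_eq_univ, prob_compl_eq_zero_iff hA]
    exact ((ENNReal.mul_eq_left h0 (measure_ne_top W A)).1 h1.symm)

end Ergodicity

end OUFlow

end

theorem mainTheorem1 :
    ∃ 𝒮 : ℝ → (HU ≃ₗᵢ[ℝ] HU),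
      -- `𝒮 u` is the multiplier with symbol `e^{-2iu arctan(2λ)}`
      (∀ u : ℝ, IsFourierMultiplier (symbol u) (𝒮 u)) ∧
      (∀ (u : ℝ) (A : HU → HU), IsFourierMultiplier (symbol u) A → A = 𝒮 u) ∧
      -- continuous one-parameter group
      (∀ h : HU, 𝒮 0 h = h) ∧
      (∀ (u v : ℝ) (h : HU), 𝒮 (u + v) h = 𝒮 u (𝒮 v h)) ∧
      (∀ h : HU, Continuous fun u : ℝ => 𝒮 u h) ∧
      -- `𝒮 1 = - F ∘ O ∘ F⁻¹`
      (∃ (F : H10 ≃ₗᵢ[ℝ] HU) (O : H10 ≃ₗᵢ[ℝ] H10), IsOUTransport F ∧ IsJeulinYor O ∧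
        ∀ h : HU, 𝒮 1 h = -F (O (F.symm h))) ∧
      -- decay of matrix coefficients
      (∀ g h : HU, Tendsto (fun u : ℝ => inner ℝ g (𝒮 u h)) (cocompact ℝ) (𝓝 0)) ∧
      -- the induced flow on path space
      ∀ (W : Measure UPath) [IsProbabilityMeasure W], IsWienerMeasure incl W →
        IsOrnsteinUhlenbeckLaw W ∧
        ∃ I : HU →ₗᵢ[ℝ] Lp ℝ 2 W,
          IsPaleyWiener incl W I ∧
          (∀ J : HU →ₗᵢ[ℝ] Lp ℝ 2 W, IsPaleyWiener incl W J → J = I) ∧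
          (∀ u : ℝ, ∃ T : UPath → UPath, IsInduced I (𝒮 u) T) ∧
          (∀ (u : ℝ) (T T' : UPath → UPath),
            IsInduced I (𝒮 u) T → IsInduced I (𝒮 u) T' → T =ᵐ[W] T') ∧
          ∀ S : ℝ → UPath → UPath, (∀ u : ℝ, IsInduced I (𝒮 u) (S u)) →
            S 0 =ᵐ[W] id ∧
            (∀ u v : ℝ, S (u + v) =ᵐ[W] S u ∘ S v) ∧
            (∀ u : ℝ, MeasurePreserving (S u) W W) ∧
            (∀ u : ℝ, u ≠ 0 → Ergodic (S u) W) := by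
  refine ⟨flow, isFourierMultiplier_flow, fun u A hA => hA.unique (isFourierMultiplier_flow u),
    flow_zero, flow_add, continuous_flow,
    ⟨H10.transport, jeulinYor, H10.isOUTransport_transport, isJeulinYor_jeulinYor,
      flow_one_eq_neg_transport⟩, tendsto_inner_flow, fun W _ hW => ?_⟩
  have hI := isPaleyWiener_paleyWiener hW
  refine ⟨hW.isOrnsteinUhlenbeckLaw, paleyWiener hW, hI, fun J hJ => hJ.unique hI,
    fun u => exists_isInduced hI hW (flow u), fun u T T' hT hT' => hT.ae_eq hT' hI,
    fun S hS => ⟨?_, fun u v => ?_, fun u => (hS u).measurePreserving hI hW,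
      fun u hu => (hS u).ergodic hu hI hW⟩⟩
  · exact (hS 0).ae_eq (isInduced_id flow_zero) hI
  · exact (hS (u + v)).ae_eq ((hS u).comp (hS v) (flow_add u v)) hI
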